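/- Let $\hat{\mathbb C}=\mathbb C\cup\{\infty\}$ be the Riemann sphere, with the conventions $z\cdot\infty=\infty\cdot z=\infty$ for $z\in\hat{\mathbb C}\setminus\{0\}$ and $0\cdot\infty=\infty\cdot 0=1$, and let $$\Omega=\{(z,w)\in\hat{\mathbb C}^2 : z\cdot w\neq 1\},$$ an open subset of the complex manifold $\hat{\mathbb C}^2$. Let $\mathcal H(\Omega)$ be the space of all holomorphic functions $f:\Omega\to\mathbb C$ with the topology of locally uniform convergence. For integers $p,q\ge 0$ let $f_{p,q}\in\mathcal H(\Omega)$ be the function $$f_{p,q}(z,w)=\frac{z^pw^q}{(1-zw)^{\max\{p,q\}}},$$ extended holomorphically to the points of $\Omega$ at which $z=\infty$ or $w=\infty$. Let $\mathcal H_-(\Omega)$ (the past) be the closure in $\mathcal H(\Omega)$ of the linear span of all $f_{p,q}$ with $0\le q\le p$, and let $\mathcal H_+(\Omega)$ (the future) be the closure in $\mathcal H(\Omega)$ of the linear span of all $f_{p,q}$ with $0\le p<q$. **Theorem (Canonical Decomposition).** $\mathcal H(\Omega)$ is the topological direct sum of its closed subspaces $\mathcal H_-(\Omega)$ and $\mathcal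 H_+(\Omega)$, $$\mathcal H(\Omega)=\mathcal H_-(\Omega)\oplus\mathcal H_+(\Omega);$$ that is, every $f\in\mathcal H(\Omega)$ can be written in exactly one way as $f=f_-+f_+$ with $f_\pm\in\mathcal H_\pm(\Omega)$, and the projections $f\mapsto f_\pm$ are continuous. -/

import Mathlib

open Filter Topology Manifold ContDiff TopologicalSpace

noncomputable section

namespace OmegaPaper

/-- The Riemann sphere `ℂ ∪ {∞}`, with the topology of the one-point compactification. -/
abbrev Sphere : Type := OnePoint ℂ

/-- The coordinate `z` on the sphere (with the value `0` at `∞`, outside its chart domain). -/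
def coordZero (x : Sphere) : ℂ := x.elim 0 id

/-- The coordinate `1 / z` on the sphere, with `1 / ∞ = 0`
(and the value `0` at `0`, outside its chart domain). -/
def coordInf (x : Sphere) : ℂ := x.elim 0 (fun z => z⁻¹)

/-- The inverse of the coordinate `1 / z`: it sends `0` to `∞` and `a ≠ 0` to `1 / a`. -/
def coordInfSymm (a : ℂ) : Sphere :=
  open Classical in if a = 0 then OnePoint.infty else ((a⁻¹ : ℂ) : Sphere)

@[simp] lemma coordZero_coe (z : ℂ) : coordZero (z : Sphere) = z := rfl
@[simp] lemma coordZero_infty : coordZero (OnePoint.infty : Sphere) = 0 := rfl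
@[simp] lemma coordInf_coe (z : ℂ) : coordInf (z : Sphere) = z⁻¹ := rfl
@[simp] lemma coordInf_infty : coordInf (OnePoint.infty : Sphere) = 0 := rfl

lemma continuousAt_coordZero {x : Sphere} (hx : x ≠ OnePoint.infty) :
    ContinuousAt coordZero x := by
  induction x using OnePoint.rec with
  | infty => exact absurd rfl hx
  | coe z => exact OnePoint.continuousAt_coe.2 continuousAt_id

lemma continuousAt_coordInf {x : Sphere} (hx : x ≠ ((0 : ℂ) : Sphere)) :
    ContinuousAt coordInf x := by
  induction x using OnePoint.rec with
  | infty =>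
    rw [OnePoint.continuousAt_infty']
    rw [Filter.coclosedCompact_eq_cocompact]
    exact tendsto_inv₀_cobounded.mono_left (by rw [Metric.cobounded_eq_cocompact])
  | coe z =>
    have hz : z ≠ 0 := fun h => hx (by rw [h])
    exact OnePoint.continuousAt_coe.2 (continuousAt_inv₀ hz)

lemma continuous_coordInfSymm : Continuous coordInfSymm := by
  rw [continuous_iff_continuousAt]
  intro a
  by_cases ha : a = 0
  · subst ha
    rw [continuousAt_iff_punctured_nhds]
    have h1 : Tendsto (fun a : ℂ => ((a⁻¹ : ℂ) : Sphere)) (𝓝[≠] 0) (𝓝 OnePoint.infty) := by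
      have h2 : Tendsto (fun z : ℂ => (z : Sphere)) (Bornology.cobounded ℂ)
          (𝓝 OnePoint.infty) := by
        have := OnePoint.tendsto_coe_infty (X := ℂ)
        rwa [Filter.coclosedCompact_eq_cocompact, ← Metric.cobounded_eq_cocompact] at this
      exact h2.comp tendsto_inv₀_nhdsNE_zero
    have h0 : coordInfSymm 0 = OnePoint.infty := by simp [coordInfSymm]
    rw [h0]
    refine h1.congr' ?_
    filter_upwards [self_mem_nhdsWithin] with b hb
    have hb' : b ≠ 0 := hb
    simp [coordInfSymm, hb']
  · have h1 : ContinuousAt (fun a : ℂ => ((a⁻¹ : ℂ) : Sphere)) a :=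
      OnePoint.continuous_coe.continuousAt.comp (continuousAt_inv₀ ha)
    refine h1.congr ?_
    filter_upwards [isOpen_ne.mem_nhds ha] with b hb
    simp [coordInfSymm, hb]

/-- The chart `z` on `ℂ`. -/
def chartZero : OpenPartialHomeomorph Sphere ℂ where
  toFun := coordZero
  invFun z := (z : Sphere)
  source := {OnePoint.infty}ᶜ
  target := Set.univ
  map_source' _ _ := Set.mem_univ _
  map_target' z _ := OnePoint.coe_ne_infty z
  left_inv' x hx := by
    induction x using OnePoint.rec with
    | infty => exact absurd rfl hx
    | coe z => rfl
  right_inv' _ _ := rfl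
  open_source := isOpen_compl_singleton
  open_target := isOpen_univ
  continuousOn_toFun _ hx := (continuousAt_coordZero hx).continuousWithinAt
  continuousOn_invFun := OnePoint.continuous_coe.continuousOn

/-- The chart `1 / z` on the sphere without `0`. -/
def chartInf : OpenPartialHomeomorph Sphere ℂ where
  toFun := coordInf
  invFun := coordInfSymm
  source := {((0 : ℂ) : Sphere)}ᶜ
  target := Set.univ
  map_source' _ _ := Set.mem_univ _
  map_target' a _ := by
    by_cases ha : a = 0
    · simp [coordInfSymm, ha]
    · simp [coordInfSymm, ha]
  left_inv' x hx := by
    induction x using OnePoint.rec with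
    | infty => simp [coordInfSymm]
    | coe z =>
      have hz : z ≠ 0 := fun h => hx (by rw [h]; rfl)
      simp [coordInfSymm, hz]
  right_inv' a _ := by
    by_cases ha : a = 0
    · simp [coordInfSymm, ha]
    · simp [coordInfSymm, ha]
  open_source := isOpen_compl_singleton
  open_target := isOpen_univ
  continuousOn_toFun _ hx := (continuousAt_coordInf hx).continuousWithinAt
  continuousOn_invFun := continuous_coordInfSymm.continuousOn

@[simp] lemma chartZero_apply (x : Sphere) : chartZero x = coordZero x := rfl
@[simp] lemma chartZero_symm_apply (z : ℂ) : chartZero.symm z = (z : Sphere) := rfl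
@[simp] lemma chartInf_apply (x : Sphere) : chartInf x = coordInf x := rfl
@[simp] lemma chartInf_symm_apply (a : ℂ) : chartInf.symm a = coordInfSymm a := rfl
@[simp] lemma chartZero_source : chartZero.source = {OnePoint.infty}ᶜ := rfl
@[simp] lemma chartZero_target : chartZero.target = Set.univ := rfl
@[simp] lemma chartInf_source : chartInf.source = {((0 : ℂ) : Sphere)}ᶜ := rfl
@[simp] lemma chartInf_target : chartInf.target = Set.univ := rfl

lemma coordInf_coordInfSymm (a : ℂ) : coordInf (coordInfSymm a) = a :=
  chartInf.right_inv' (Set.mem_univ a)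

/-- The complex structure of the Riemann sphere, given by the two charts `z` and `1 / z`. -/
instance : ChartedSpace ℂ Sphere where
  atlas := {chartZero, chartInf}
  chartAt x := open Classical in if x = OnePoint.infty then chartInf else chartZero
  mem_chart_source x := by
    by_cases hx : x = OnePoint.infty
    · simp [hx, chartInf]
    · simp [hx, chartZero]
  chart_mem_atlas x := by
    by_cases hx : x = OnePoint.infty
    · simp [hx]
    · simp [hx]

instance : IsManifold 𝓘(ℂ) ω Sphere := by
  apply isManifold_of_contDiffOn
  have key : ∀ s : Set ℂ, (∀ x ∈ s, x ≠ 0) → ContDiffOn ℂ ω (fun z : ℂ => z⁻¹) s :=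
    fun s hs x hx => (contDiffAt_inv ℂ (hs x hx)).contDiffWithinAt
  rintro e e' (rfl | rfl) (rfl | rfl)
  · exact contDiffOn_id.congr (fun x _ => by simp)
  · refine (key _ ?_).congr (fun x _ => by simp)
    rintro x hx rfl
    simp at hx
  · have hne : ∀ x ∈ 𝓘(ℂ).symm ⁻¹' (chartInf.symm.trans chartZero).source ∩
        Set.range 𝓘(ℂ), x ≠ 0 := by
      rintro x hx rfl
      simp [coordInfSymm] at hx
    refine (key _ hne).congr (fun x hx => ?_)
    have := hne x hx
    simp [coordInfSymm, this]
  · exact contDiffOn_id.congr (fun x _ => by simp [coordInf_coordInfSymm])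

/-- Multiplication on the sphere with the conventions `z * ∞ = ∞ * z = ∞` for `z ≠ 0` and
`0 * ∞ = ∞ * 0 = 1`. -/
def sphereMul : Sphere → Sphere → Sphere
  | OnePoint.some z, OnePoint.some w => ((z * w : ℂ) : Sphere)
  | OnePoint.some z, OnePoint.infty =>
      open Classical in if z = 0 then ((1 : ℂ) : Sphere) else OnePoint.infty
  | OnePoint.infty, OnePoint.some w =>
      open Classical in if w = 0 then ((1 : ℂ) : Sphere) else OnePoint.infty
  | OnePoint.infty, OnePoint.infty => OnePoint.infty

/-- The underlying set `{(z, w) : z * w ≠ 1}` of `Ω`. -/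
def OmegaSet : Set (Sphere × Sphere) := {x | sphereMul x.1 x.2 ≠ ((1 : ℂ) : Sphere)}

lemma coe_mem_OmegaSet (z w : ℂ) :
    ((z : Sphere), (w : Sphere)) ∈ OmegaSet ↔ z * w ≠ 1 :=
  not_congr OnePoint.coe_eq_coe

/-- In the coordinates `z, w`, valid where both points are finite, `Ω` is `{z * w ≠ 1}`. -/
lemma mem_OmegaSet_finite {x : Sphere × Sphere} (h1 : x.1 ≠ OnePoint.infty)
    (h2 : x.2 ≠ OnePoint.infty) :
    x ∈ OmegaSet ↔ coordZero x.1 * coordZero x.2 ≠ 1 := by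
  obtain ⟨a, b⟩ := x
  induction a using OnePoint.rec with
  | infty => exact absurd rfl h1
  | coe z =>
    induction b using OnePoint.rec with
    | infty => exact absurd rfl h2
    | coe w => exact coe_mem_OmegaSet z w

/-- In the coordinates `1 / z, 1 / w`, valid where both points are nonzero,
`Ω` is `{(1 / z) * (1 / w) ≠ 1}`. -/
lemma mem_OmegaSet_nonzero {x : Sphere × Sphere} (h1 : x.1 ≠ ((0 : ℂ) : Sphere))
    (h2 : x.2 ≠ ((0 : ℂ) : Sphere)) :
    x ∈ OmegaSet ↔ coordInf x.1 * coordInf x.2 ≠ 1 := by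
  obtain ⟨a, b⟩ := x
  induction a using OnePoint.rec with
  | infty =>
    induction b using OnePoint.rec with
    | infty => simp [OmegaSet, sphereMul]
    | coe w =>
      have hw : w ≠ 0 := fun h => h2 (by rw [h])
      simp [OmegaSet, sphereMul, hw]
  | coe z =>
    have hz : z ≠ 0 := fun h => h1 (by rw [h])
    induction b using OnePoint.rec with
    | infty => simp [OmegaSet, sphereMul, hz]
    | coe w =>
      rw [coe_mem_OmegaSet, coordInf_coe, coordInf_coe, ← mul_inv, Ne, Ne, inv_eq_one]

/-- A point of `Ω` with an infinite entry has no zero entry. -/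
lemma ne_zero_of_infty {x : Sphere × Sphere} (hx : x ∈ OmegaSet)
    (h : ¬ (x.1 ≠ OnePoint.infty ∧ x.2 ≠ OnePoint.infty)) :
    x.1 ≠ ((0 : ℂ) : Sphere) ∧ x.2 ≠ ((0 : ℂ) : Sphere) := by
  obtain ⟨a, b⟩ := x
  induction a using OnePoint.rec with
  | infty =>
    refine ⟨OnePoint.infty_ne_coe 0, ?_⟩
    rintro (rfl : b = ((0 : ℂ) : Sphere))
    exact hx (if_pos rfl)
  | coe z =>
    induction b using OnePoint.rec with
    | infty =>
      refine ⟨?_, OnePoint.infty_ne_coe 0⟩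
      rintro h0
      have hz : z = 0 := OnePoint.coe_injective h0
      subst hz
      exact hx (if_pos rfl)
    | coe w => exact absurd ⟨OnePoint.coe_ne_infty z, OnePoint.coe_ne_infty w⟩ h

lemma eventually_finite {x : Sphere × Sphere}
    (h : x.1 ≠ OnePoint.infty ∧ x.2 ≠ OnePoint.infty) :
    ∀ᶠ y in 𝓝 x, y.1 ≠ OnePoint.infty ∧ y.2 ≠ OnePoint.infty :=
  ((isOpen_ne.preimage continuous_fst).inter (isOpen_ne.preimage continuous_snd)).mem_nhds h

lemma eventually_nonzero {x : Sphere × Sphere}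
    (h : x.1 ≠ ((0 : ℂ) : Sphere) ∧ x.2 ≠ ((0 : ℂ) : Sphere)) :
    ∀ᶠ y in 𝓝 x, y.1 ≠ ((0 : ℂ) : Sphere) ∧ y.2 ≠ ((0 : ℂ) : Sphere) :=
  ((isOpen_ne.preimage continuous_fst).inter (isOpen_ne.preimage continuous_snd)).mem_nhds h

lemma isOpen_OmegaSet : IsOpen OmegaSet := by
  rw [isOpen_iff_mem_nhds]
  intro x hx
  by_cases h : x.1 ≠ OnePoint.infty ∧ x.2 ≠ OnePoint.infty
  · have hc : ContinuousAt (fun y : Sphere × Sphere => coordZero y.1 * coordZero y.2) x :=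
      ((continuousAt_coordZero h.1).comp continuousAt_fst).mul
        ((continuousAt_coordZero h.2).comp continuousAt_snd)
    filter_upwards [eventually_finite h,
      hc.eventually_ne ((mem_OmegaSet_finite h.1 h.2).1 hx)] with y hy hy'
    exact (mem_OmegaSet_finite hy.1 hy.2).2 hy'
  · have h' := ne_zero_of_infty hx h
    have hc : ContinuousAt (fun y : Sphere × Sphere => coordInf y.1 * coordInf y.2) x :=
      ((continuousAt_coordInf h'.1).comp continuousAt_fst).mul
        ((continuousAt_coordInf h'.2).comp continuousAt_snd)
    filter_upwards [eventually_nonzero h',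
      hc.eventually_ne ((mem_OmegaSet_nonzero h'.1 h'.2).1 hx)] with y hy hy'
    exact (mem_OmegaSet_nonzero hy.1 hy.2).2 hy'

/-- The complement `Ω` of the complexified unit circle, as an open subset of the product of two
Riemann spheres; as such it carries the structure of an open complex submanifold. -/
def Omega : Opens (Sphere × Sphere) := ⟨OmegaSet, isOpen_OmegaSet⟩

/-- Holomorphy of a function on `Ω`: complex differentiability at every point of the complex
manifold `Ω` (read in the charts of the two spheres). -/
def IsHolomorphic (f : Omega → ℂ) : Prop :=
  MDifferentiable (𝓘(ℂ).prod 𝓘(ℂ)) 𝓘(ℂ) f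

/-- The holomorphic functions on `Ω` as a linear subspace of the space `C(Ω, ℂ)` of continuous
functions. -/
def holSubmodule : Submodule ℂ C(Omega, ℂ) where
  carrier := {f | IsHolomorphic f}
  add_mem' {f g} hf hg := by
    have hf' : MDifferentiable (𝓘(ℂ).prod 𝓘(ℂ)) 𝓘(ℂ) f := hf
    have hg' : MDifferentiable (𝓘(ℂ).prod 𝓘(ℂ)) 𝓘(ℂ) g := hg
    exact hf'.add hg'
  zero_mem' := by
    show MDifferentiable (𝓘(ℂ).prod 𝓘(ℂ)) 𝓘(ℂ) (fun _ : Omega => (0 : ℂ))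
    exact mdifferentiable_const
  smul_mem' c f hf := by
    have hf' : MDifferentiable (𝓘(ℂ).prod 𝓘(ℂ)) 𝓘(ℂ) f := hf
    exact hf'.const_smul c

/-- The space of all holomorphic functions on `Ω`, with pointwise operations and with the
compact-open topology inherited from `C(Ω, ℂ)`, which on the locally compact space `Ω` is the
topology of locally uniform convergence. -/
def HOmega : Type := holSubmodule

instance : TopologicalSpace HOmega := inferInstanceAs (TopologicalSpace holSubmodule)

instance : AddCommGroup HOmega := inferInstanceAs (AddCommGroup holSubmodule)

instance : Module ℂ HOmega := inferInstanceAs (Module ℂ holSubmodule)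

instance : IsTopologicalAddGroup HOmega := Submodule.topologicalAddGroup holSubmodule

instance : ContinuousSMul ℂ HOmega := inferInstanceAs (ContinuousSMul ℂ holSubmodule)

instance : T2Space HOmega := inferInstanceAs (T2Space holSubmodule)

instance : FunLike HOmega Omega ℂ where
  coe f := f.1
  coe_injective _ _ h := Subtype.ext (DFunLike.coe_injective h)

lemma HOmega.isHolomorphic (f : HOmega) : IsHolomorphic f := f.2

/-- The function `z ^ p * w ^ q / (1 - z * w) ^ max p q` on `Ω`. At points with an infinite entry
it is read in the coordinates `a = 1 / z`, `b = 1 / w`, in which it becomes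
`a ^ (m - p) * b ^ (m - q) / (a * b - 1) ^ m` with `m = max p q`. -/
def basisFun (p q : ℕ) (x : Omega) : ℂ :=
  open Classical in
  if x.1.1 ≠ OnePoint.infty ∧ x.1.2 ≠ OnePoint.infty then
    coordZero x.1.1 ^ p * coordZero x.1.2 ^ q /
      (1 - coordZero x.1.1 * coordZero x.1.2) ^ max p q
  else
    coordInf x.1.1 ^ (max p q - p) * coordInf x.1.2 ^ (max p q - q) /
      (coordInf x.1.1 * coordInf x.1.2 - 1) ^ max p q

/-- Wherever both entries are nonzero, the function is given by the formula in the coordinates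
`1 / z`, `1 / w`. -/
lemma basisFun_eq_nonzero (p q : ℕ) (x : Omega)
    (h : x.1.1 ≠ ((0 : ℂ) : Sphere) ∧ x.1.2 ≠ ((0 : ℂ) : Sphere)) :
    basisFun p q x = coordInf x.1.1 ^ (max p q - p) * coordInf x.1.2 ^ (max p q - q) /
      (coordInf x.1.1 * coordInf x.1.2 - 1) ^ max p q := by
  unfold basisFun
  split_ifs with h0
  · obtain ⟨⟨u, v⟩, hx⟩ := x
    induction u using OnePoint.rec with
    | infty => exact absurd rfl h0.1
    | coe z =>
      induction v using OnePoint.rec with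
      | infty => exact absurd rfl h0.2
      | coe w =>
        have hz : z ≠ 0 := fun e => h.1 (by simp only [e])
        have hw : w ≠ 0 := fun e => h.2 (by simp only [e])
        have hzw : z * w ≠ 1 := (coe_mem_OmegaSet z w).1 hx
        have hd : 1 - z * w ≠ 0 := sub_ne_zero.2 hzw.symm
        simp only [coordZero_coe, coordInf_coe]
        have e1 : z⁻¹ * w⁻¹ - 1 = (1 - z * w) * (z⁻¹ * w⁻¹) := by field_simp
        have e2 : z ^ p * z⁻¹ ^ max p q = z⁻¹ ^ (max p q - p) := by
          nth_rewrite 1 [← Nat.add_sub_cancel' (le_max_left p q)]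
          rw [pow_add, ← mul_assoc, ← mul_pow, mul_inv_cancel₀ hz, one_pow, one_mul]
        have e3 : w ^ q * w⁻¹ ^ max p q = w⁻¹ ^ (max p q - q) := by
          nth_rewrite 1 [← Nat.add_sub_cancel' (le_max_right p q)]
          rw [pow_add, ← mul_assoc, ← mul_pow, mul_inv_cancel₀ hw, one_pow, one_mul]
        have hne : (z⁻¹ * w⁻¹) ^ max p q ≠ 0 :=
          pow_ne_zero _ (mul_ne_zero (inv_ne_zero hz) (inv_ne_zero hw))
        rw [e1, mul_pow (1 - z * w), ← e2, ← e3, ← mul_div_mul_right _ _ hne, mul_pow z⁻¹]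
        congr 1
        ring
  · rfl

lemma contMDiffAt_coordZero {x : Sphere} (hx : x ≠ OnePoint.infty) :
    ContMDiffAt 𝓘(ℂ) 𝓘(ℂ) ω coordZero x :=
  contMDiffAt_of_mem_maximalAtlas (e := chartZero)
    (IsManifold.subset_maximalAtlas (Or.inl rfl)) hx

lemma contMDiffAt_coordInf {x : Sphere} (hx : x ≠ ((0 : ℂ) : Sphere)) :
    ContMDiffAt 𝓘(ℂ) 𝓘(ℂ) ω coordInf x :=
  contMDiffAt_of_mem_maximalAtlas (e := chartInf)
    (IsManifold.subset_maximalAtlas (Or.inr rfl)) hx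

lemma mdifferentiableAt_pair {c : Sphere → ℂ} {x : Omega}
    (h1 : ContMDiffAt 𝓘(ℂ) 𝓘(ℂ) ω c x.1.1) (h2 : ContMDiffAt 𝓘(ℂ) 𝓘(ℂ) ω c x.1.2) :
    MDifferentiableAt (𝓘(ℂ).prod 𝓘(ℂ)) 𝓘(ℂ, ℂ × ℂ)
      (fun y : Omega => (c y.1.1, c y.1.2)) x := by
  have hs : ContMDiffAt (𝓘(ℂ).prod 𝓘(ℂ)) (𝓘(ℂ).prod 𝓘(ℂ)) ω
      (fun y : Omega => y.1) x := contMDiff_subtype_val.contMDiffAt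
  have k1 := ContMDiffAt.comp x h1 (contMDiffAt_fst.comp x hs)
  have k2 := ContMDiffAt.comp x h2 (contMDiffAt_snd.comp x hs)
  exact (k1.prodMk_space k2).mdifferentiableAt (by simp)

lemma isHolomorphic_basisFun (p q : ℕ) : IsHolomorphic (basisFun p q) := by
  intro x
  by_cases h : x.1.1 ≠ OnePoint.infty ∧ x.1.2 ≠ OnePoint.infty
  · have hne : 1 - coordZero x.1.1 * coordZero x.1.2 ≠ 0 :=
      sub_ne_zero.2 ((mem_OmegaSet_finite h.1 h.2).1 x.2).symm
    have hG : DifferentiableAt ℂ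
        (fun v : ℂ × ℂ => v.1 ^ p * v.2 ^ q / (1 - v.1 * v.2) ^ max p q)
        (coordZero x.1.1, coordZero x.1.2) := by
      simp only [div_eq_mul_inv]
      exact DifferentiableAt.fun_mul (by fun_prop)
        (DifferentiableAt.fun_inv (by fun_prop) (pow_ne_zero _ hne))
    have := hG.mdifferentiableAt.comp x
      (mdifferentiableAt_pair (contMDiffAt_coordZero h.1) (contMDiffAt_coordZero h.2))
    refine this.congr_of_eventuallyEq ?_
    filter_upwards [continuous_subtype_val.continuousAt.eventually (eventually_finite h)]
      with y hy
    exact if_pos hy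
  · have h' := ne_zero_of_infty x.2 h
    have hne : coordInf x.1.1 * coordInf x.1.2 - 1 ≠ 0 :=
      sub_ne_zero.2 ((mem_OmegaSet_nonzero h'.1 h'.2).1 x.2)
    have hG : DifferentiableAt ℂ
        (fun v : ℂ × ℂ => v.1 ^ (max p q - p) * v.2 ^ (max p q - q) /
          (v.1 * v.2 - 1) ^ max p q)
        (coordInf x.1.1, coordInf x.1.2) := by
      simp only [div_eq_mul_inv]
      exact DifferentiableAt.fun_mul (by fun_prop)
        (DifferentiableAt.fun_inv (by fun_prop) (pow_ne_zero _ hne))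
    have := hG.mdifferentiableAt.comp x
      (mdifferentiableAt_pair (contMDiffAt_coordInf h'.1) (contMDiffAt_coordInf h'.2))
    refine this.congr_of_eventuallyEq ?_
    filter_upwards [continuous_subtype_val.continuousAt.eventually (eventually_nonzero h')]
      with y hy
    exact basisFun_eq_nonzero p q y hy

/-- The function `f_{p,q}` as an element of the space of holomorphic functions on `Ω`. -/
def basisElt (p q : ℕ) : HOmega :=
  ⟨⟨basisFun p q, (isHolomorphic_basisFun p q).continuous⟩, isHolomorphic_basisFun p q⟩

/-- The past: the closure of the linear span of all `f_{p,q}` with `q ≤ p`. -/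
def past : Submodule ℂ HOmega :=
  (Submodule.span ℂ {f | ∃ p q : ℕ, q ≤ p ∧ f = basisElt p q}).topologicalClosure

/-- The future: the closure of the linear span of all `f_{p,q}` with `p < q`. -/
def future : Submodule ℂ HOmega :=
  (Submodule.span ℂ {f | ∃ p q : ℕ, p < q ∧ f = basisElt p q}).topologicalClosure

end OmegaPaper

end

/-!
The group `ℂ \ {0}` acts on `Ω` by `rot c (z, w) = (c z, c⁻¹ w)`, because the product `z w` does
not change, and `f_{p,q}` is homogeneous of degree `p - q` for this action. The past and the future
therefore consist of the holomorphic functions with components of degree `≥ 0` and `< 0` only, and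
the decomposition is the splitting of the Laurent series of `c ↦ f (rot c x)` at `c = 1` into its
two parts.

In terms of Cauchy's formula on the annulus `1/2 ≤ |c| ≤ 2` the two parts are integrals of
`f (rot c x) / (c - 1)` over the outer and the inner circle (`projPast` and `projFuture`, with
`projPast_add_projFuture`). Each is an average of translates of `f` with a continuous weight. Such
an average depends continuously on the weight and on `f` (`continuous_average`), and it is
holomorphic on `Ω` (`isHolomorphic_average`). Expanding the kernel in a geometric series writes
`projPast f` and `projFuture f` as limits of sums of homogeneous components of `f`
(`tendsto_projPast`, `tendsto_projFuture`), which shows at once that `projPast` kills the future and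
`projFuture` kills the past.

It remains to see that a component `F` of degree `n ≥ 0` lies in the past; the case of negative
degree is the same with the factors exchanged. The curve `t ↦ (1 / (1 + t), t)` meets every orbit on
which `f_{1,0}` has no zero in the point with `f_{1,0} = 1` and `f_{1,1} = t`. By homogeneity
`F = f_{1,0} ^ n * h(f_{1,1})`, where the restriction `h` of `F` to the curve is entire, and this
extends to all of `Ω` by density. As `f_{q+n,q} = f_{1,0} ^ n * f_{1,1} ^ q`, the Taylor series of
`h` expands `F` into functions of the past (`mem_topologicalClosure_span`).
-/

noncomputable section

/-! ### Integrals depending holomorphically on a parameter, and circle averages -/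

/-- An integral over an interval of functions that are holomorphic in a parameter, and jointly
continuous, is holomorphic in the parameter. Only the integrand itself has to be controlled, since
the Schwarz lemma bounds its derivative in the parameter. -/
theorem differentiableOn_intervalIntegral_of_continuousOn {E : Type*} [NormedAddCommGroup E]
    [NormedSpace ℂ E] [ProperSpace E] {G : E → ℝ → ℂ} {D : Set E} (hD : IsOpen D)
    (hc : ContinuousOn (Function.uncurry G) (D ×ˢ Set.univ))
    (hd : ∀ θ, DifferentiableOn ℂ (fun v => G v θ) D) {a b : ℝ} (hab : a ≤ b) :
    DifferentiableOn ℂ (fun v => ∫ θ in a..b, G v θ) D := by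
  intro x₀ hx₀
  obtain ⟨r, hr, hrD⟩ := Metric.nhds_basis_closedBall.mem_iff.1 (hD.mem_nhds hx₀)
  have hcA : ∀ v ∈ D, ∀ θ, ContinuousAt (Function.uncurry G) (v, θ) := fun v hv θ =>
    hc.continuousAt ((hD.prod isOpen_univ).mem_nhds ⟨hv, trivial⟩)
  have hcθ : ∀ v ∈ D, Continuous (G v) := fun v hv => continuous_iff_continuousAt.2 fun θ =>
    (hcA v hv θ).comp (f := fun θ => (v, θ)) (by fun_prop)
  obtain ⟨M, hM⟩ := ((isCompact_closedBall x₀ r).prod (isCompact_Icc (a := a) (b := b)))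
    |>.exists_bound_of_continuousOn (hc.mono (Set.prod_mono hrD (Set.subset_univ _)))
  -- Applied to `G · θ - G · θ₀`, the Schwarz lemma makes the derivative continuous in `θ`.
  have hfd : Continuous fun θ => fderiv ℂ (fun v => G v θ) x₀ := by
    refine continuous_iff_continuousAt.2 fun θ₀ => Metric.continuousAt_iff'.2 fun ε hε => ?_
    have hev : ∀ᶠ θ in 𝓝 θ₀, ∀ v ∈ Metric.closedBall x₀ r, ‖G v θ - G v θ₀‖ < ε * r / 4 := by
      refine (isCompact_closedBall x₀ r).eventually_forall_of_forall_eventually fun v hv => ?_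
      have h1 : ContinuousAt (fun p : ℝ × E => ‖G p.2 p.1 - G p.2 θ₀‖) (θ₀, v) := by
        have h2 := (hcA v (hrD hv) θ₀).comp (f := fun p : ℝ × E => (p.2, p.1)) (x := (θ₀, v))
          (by fun_prop)
        have h3 := (hcA v (hrD hv) θ₀).comp (f := fun p : ℝ × E => (p.2, θ₀)) (x := (θ₀, v))
          (by fun_prop)
        exact (h2.sub h3).norm
      refine h1.eventually_lt continuousAt_const ?_
      simp only [sub_self, norm_zero]
      positivity
    filter_upwards [hev] with θ hθ
    have hdx : ∀ θ, DifferentiableAt ℂ (fun v => G v θ) x₀ := fun θ =>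
      (hd θ).differentiableAt (hD.mem_nhds hx₀)
    rw [dist_eq_norm, ← fderiv_fun_sub (hdx θ) (hdx θ₀)]
    have hle := Complex.norm_fderiv_le_div_of_mapsTo_ball (c := x₀) (R₁ := r) (R₂ := ε * r / 2)
      (f := fun v => G v θ - G v θ₀)
      (((hd θ).sub (hd θ₀)).mono (Metric.ball_subset_closedBall.trans hrD)) ?_ hr
    · refine hle.trans_lt ?_
      rw [div_lt_iff₀ hr]
      nlinarith
    · intro v hv
      rw [Metric.mem_closedBall, dist_eq_norm]
      refine (norm_sub_le _ _).trans ?_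
      have h1 := hθ v (Metric.ball_subset_closedBall hv)
      have h2 := hθ x₀ (Metric.mem_closedBall_self hr.le)
      linarith
  have hbd : ∀ θ ∈ Set.Icc a b, ∀ x ∈ Metric.ball x₀ (r / 2),
      ‖fderiv ℂ (fun v => G v θ) x‖ ≤ (2 * M) / (r / 2) := by
    intro θ hθ x hx
    have hsub : Metric.ball x (r / 2) ⊆ Metric.closedBall x₀ r := by
      refine (Metric.ball_subset_ball' ?_).trans Metric.ball_subset_closedBall
      rw [Metric.mem_ball] at hx
      linarith
    refine Complex.norm_fderiv_le_div_of_mapsTo_ball ((hd θ).mono (hsub.trans hrD)) ?_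
      (by positivity)
    intro v hv
    rw [Metric.mem_closedBall, dist_eq_norm]
    refine (norm_sub_le _ _).trans ?_
    have h1 := hM (v, θ) ⟨hsub hv, hθ⟩
    have h2 := hM (x, θ) ⟨hsub (Metric.mem_ball_self (by positivity)), hθ⟩
    simp only [Function.uncurry] at h1 h2
    linarith
  have hball : Metric.ball x₀ (r / 2) ⊆ D :=
    (Metric.ball_subset_ball (by linarith)).trans (Metric.ball_subset_closedBall.trans hrD)
  have key := hasFDerivAt_integral_of_dominated_of_fderiv_le (𝕜 := ℂ)
    (μ := MeasureTheory.volume.restrict (Set.Ioc a b)) (F := G)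
    (F' := fun x θ => fderiv ℂ (fun v => G v θ) x) (bound := fun _ => 2 * M / (r / 2))
    (x₀ := x₀) (s := Metric.ball x₀ (r / 2)) (Metric.ball_mem_nhds _ (by positivity))
    (by
      filter_upwards [hD.mem_nhds hx₀] with x hx
      exact (hcθ x hx).aestronglyMeasurable)
    ((hcθ x₀ hx₀).integrableOn_Ioc) hfd.aestronglyMeasurable
    (by
      refine (MeasureTheory.ae_restrict_iff' measurableSet_Ioc).2 (Eventually.of_forall ?_)
      exact fun θ hθ x hx => hbd θ (Set.Ioc_subset_Icc_self hθ) x hx)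
    (continuous_const.integrableOn_Ioc)
    (Eventually.of_forall fun θ x hx =>
      ((hd θ).differentiableAt (hD.mem_nhds (hball hx))).hasFDerivAt)
  simp only [intervalIntegral.integral_of_le hab]
  exact key.differentiableAt.differentiableWithinAt

lemma circleAverage_eq_of_differentiableOn_compl_zero_aux {g : ℂ → ℂ}
    (hg : DifferentiableOn ℂ g {0}ᶜ) {r R : ℝ} (hr : 0 < r) (hrR : r ≤ R) :
    Real.circleAverage g 0 R = Real.circleAverage g 0 r := by
  rw [Real.circleAverage_eq_circleIntegral hr.ne',
    Real.circleAverage_eq_circleIntegral (hr.trans_le hrR).ne']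
  congr 1
  refine Complex.circleIntegral_sub_center_inv_smul_eq_of_differentiable_on_annulus_off_countable
    hr hrR Set.countable_empty (hg.continuousOn.mono ?_) ?_
  · rintro z ⟨-, hz⟩ rfl
    exact hz (Metric.mem_ball_self hr)
  · rintro z ⟨⟨-, hz⟩, -⟩
    refine hg.differentiableAt (isOpen_compl_singleton.mem_nhds ?_)
    rintro rfl
    exact hz (Metric.mem_closedBall_self hr.le)

/-- The averages of a holomorphic function on `ℂ \ {0}` over circles around `0` agree. -/
lemma circleAverage_eq_of_differentiableOn_compl_zero {g : ℂ → ℂ}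
    (hg : DifferentiableOn ℂ g {0}ᶜ) {r R : ℝ} (hr : 0 < r) (hR : 0 < R) :
    Real.circleAverage g 0 R = Real.circleAverage g 0 r := by
  rcases le_total r R with h | h
  · exact circleAverage_eq_of_differentiableOn_compl_zero_aux hg hr h
  · exact (circleAverage_eq_of_differentiableOn_compl_zero_aux hg hR h).symm

/-- Circle averages around `0` of a holomorphic function on `ℂ \ {0}` are invariant under
dilations and rotations of the variable. -/
lemma circleAverage_comp_mul_right {g : ℂ → ℂ} (hg : DifferentiableOn ℂ g {0}ᶜ) {R : ℝ}
    (hR : 0 < R) {μ : ℂ} (hμ : μ ≠ 0) :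
    Real.circleAverage (fun z => g (z * μ)) 0 R = Real.circleAverage g 0 R := by
  have hμR : 0 < R * ‖μ‖ := mul_pos hR (norm_pos_iff.2 hμ)
  rw [circleAverage_eq_of_differentiableOn_compl_zero hg hμR hR,
    Real.circleAverage_eq_integral_add (R := R * ‖μ‖) μ.arg, Real.circleAverage_def]
  congr 2 with θ
  congr 1
  conv_lhs => rw [← Complex.norm_mul_exp_arg_mul_I μ]
  simp only [circleMap, zero_add, Complex.ofReal_mul, Complex.ofReal_add, add_mul, Complex.exp_add]
  ring

lemma circleAverage_zpow_eq_zero {n : ℤ} (hn : n ≠ 0) {R : ℝ} (hR : 0 < R) :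
    Real.circleAverage (fun z : ℂ => z ^ n) 0 R = 0 := by
  rw [Real.circleAverage_eq_circleIntegral hR.ne']
  have h : (∮ z in C(0, R), (z - 0)⁻¹ • z ^ n) = ∮ z in C(0, R), (z - 0) ^ (n - 1) := by
    refine circleIntegral.integral_congr hR.le fun z hz => ?_
    have hz0 : z ≠ 0 := by
      rintro rfl
      simp at hz
      exact hR.ne hz
    simp only [sub_zero, smul_eq_mul, zpow_sub_one₀ hz0]
    ring
  rw [h, circleIntegral.integral_sub_zpow_of_ne (by omega), smul_zero]

/-- **Cauchy's integral formula** at the point `1` for the annulus `1/2 ≤ |z| ≤ 2`. -/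
lemma circleAverage_annulus {g : ℂ → ℂ} (hg : DifferentiableOn ℂ g {0}ᶜ) :
    Real.circleAverage (fun z => (1 - z⁻¹)⁻¹ * g z) 0 2 +
      Real.circleAverage (fun z => z * (1 - z)⁻¹ * g z) 0 2⁻¹ = g 1 := by
  have hne : ∀ {R : ℝ}, 0 < R → R ≠ 1 → ∀ z ∈ Metric.sphere (0 : ℂ) |R|, z ≠ 0 ∧ z ≠ 1 := by
    intro R hR hR1 z hz
    rw [abs_of_pos hR, mem_sphere_zero_iff_norm] at hz
    refine ⟨fun h => ?_, fun h => ?_⟩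
    · rw [h, norm_zero] at hz; exact hR.ne hz
    · rw [h, norm_one] at hz; exact hR1 hz.symm
  -- The kernel `z / (z - 1)` turns the average of a function into its Cauchy integral at `1`;
  -- the difference quotient of `g` at `1` extends holomorphically across `1`.
  set h : ℂ → ℂ := fun z => z * dslope g 1 z with hh
  have hhd : DifferentiableOn ℂ h {0}ᶜ := by
    refine differentiableOn_id.mul ?_
    exact (Complex.differentiableOn_dslope (isOpen_compl_singleton.mem_nhds (by simp))).2 hg
  have hk : ∀ {R : ℝ}, 0 < R → R ≠ 1 →
      CircleIntegrable (fun z : ℂ => z * (z - 1)⁻¹ * g 1) 0 R := by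
    intro R hR hR1
    refine ContinuousOn.circleIntegrable' ?_
    refine (continuousOn_id.mul ((continuousOn_id.sub continuousOn_const).inv₀ ?_)).mul
      continuousOn_const
    exact fun z hz => sub_ne_zero.2 (hne hR hR1 z hz).2
  have hhi : ∀ {R : ℝ}, 0 < R → CircleIntegrable h 0 R := by
    intro R hR
    refine (hhd.continuousOn.mono ?_).circleIntegrable hR.le
    intro z hz h0
    rw [Set.mem_singleton_iff] at h0
    rw [h0] at hz
    simp at hz
    exact hR.ne hz
  have hsplit : ∀ {R : ℝ}, 0 < R → R ≠ 1 →
      Real.circleAverage (fun z => z * (z - 1)⁻¹ * g z) 0 R =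
        Real.circleAverage h 0 R +
          Real.circleAverage (fun z : ℂ => z * (z - 1)⁻¹) 0 R * g 1 := by
    intro R hR hR1
    have e : Real.circleAverage (fun z : ℂ => z * (z - 1)⁻¹) 0 R * g 1 =
        Real.circleAverage (fun z : ℂ => z * (z - 1)⁻¹ * g 1) 0 R := by
      have := Real.circleAverage_fun_smul (a := g 1) (f := fun z : ℂ => z * (z - 1)⁻¹) (c := 0)
        (R := R)
      simp only [smul_eq_mul] at this
      rw [mul_comm, ← this]
      congr 1 with z
      ring
    rw [e, ← Real.circleAverage_add (hhi hR) (hk hR hR1)]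
    refine Real.circleAverage_congr_sphere fun z hz => ?_
    have hz1 := (hne hR hR1 z hz).2
    simp only [hh, Pi.add_apply, dslope_of_ne _ hz1, slope_def_field]
    have := sub_ne_zero.2 hz1
    field_simp
    ring
  have e2 : Real.circleAverage (fun z => (1 - z⁻¹)⁻¹ * g z) 0 2 =
      Real.circleAverage (fun z => z * (z - 1)⁻¹ * g z) 0 2 := by
    refine Real.circleAverage_congr_sphere fun z hz => ?_
    obtain ⟨h0, h1⟩ := hne two_pos (by norm_num) z hz
    have := sub_ne_zero.2 h1
    have e : 1 - z⁻¹ = (z - 1) * z⁻¹ := by field_simp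
    simp only [e, mul_inv, inv_inv]
    ring
  have e1 : Real.circleAverage (fun z => z * (1 - z)⁻¹ * g z) 0 2⁻¹ =
      -Real.circleAverage (fun z => z * (z - 1)⁻¹ * g z) 0 2⁻¹ := by
    rw [← neg_one_smul ℂ, ← Real.circleAverage_fun_smul]
    congr 1 with z
    rw [← neg_sub z 1, inv_neg, smul_eq_mul]
    ring
  have a2 : Real.circleAverage (fun z : ℂ => z * (z - 1)⁻¹) 0 2 = 1 := by
    rw [Real.circleAverage_eq_circleIntegral two_ne_zero]
    have : (∮ z in C(0, 2), (z - 0)⁻¹ • (z * (z - 1)⁻¹)) = ∮ z in C(0, 2), (z - (1 : ℂ))⁻¹ := by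
      refine circleIntegral.integral_congr zero_le_two fun z hz => ?_
      have h0 := (hne two_pos (by norm_num) z (by rwa [abs_of_pos two_pos])).1
      simp only [sub_zero, smul_eq_mul, ← mul_assoc, inv_mul_cancel₀ h0, one_mul]
    rw [this, circleIntegral.integral_sub_inv_of_mem_ball (by simp), smul_eq_mul,
      inv_mul_cancel₀ Complex.two_pi_I_ne_zero]
  have a1 : Real.circleAverage (fun z : ℂ => z * (z - 1)⁻¹) 0 2⁻¹ = 0 := by
    have hd : DiffContOnCl ℂ (fun z : ℂ => z * (z - 1)⁻¹) (Metric.ball 0 |2⁻¹|) := by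
      refine DifferentiableOn.diffContOnCl ?_
      refine differentiableOn_id.mul ((differentiableOn_id.sub_const _).inv ?_)
      intro z hz
      have hz' := Metric.closure_ball_subset_closedBall hz
      rw [mem_closedBall_zero_iff] at hz'
      intro h0
      have h1 : z = 1 := sub_eq_zero.1 h0
      rw [h1] at hz'
      norm_num at hz'
    rw [hd.circleAverage]
    simp
  rw [e2, e1, hsplit two_pos (by norm_num), hsplit (by norm_num) (by norm_num), a2, a1,
    circleAverage_eq_of_differentiableOn_compl_zero hhd (r := 2⁻¹) (R := 2) (by norm_num)
      (by norm_num)]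
  ring

/-- The geometric series of a continuous function of modulus at most `1 / 2` converges locally
uniformly. -/
lemma tendsto_sum_pow_continuousMap {u κ : C(ℝ, ℂ)} (hu : ∀ θ, ‖u θ‖ ≤ 1 / 2)
    (hκ : ∀ θ, κ θ = (1 - u θ)⁻¹) :
    Tendsto (fun N => ∑ n ∈ Finset.range N, u ^ n) atTop (𝓝 κ) := by
  refine ContinuousMap.tendsto_of_tendstoLocallyUniformly ?_
  refine TendstoUniformly.tendstoLocallyUniformly ?_
  have h := tendstoUniformly_tsum_nat (f := fun n θ => u θ ^ n) summable_geometric_two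
    (fun n θ => by
      rw [norm_pow]
      exact pow_le_pow_left₀ (norm_nonneg _) (hu θ) n)
  have e : (fun θ => ∑' n, u θ ^ n) = κ := by
    funext θ
    rw [tsum_geometric_of_norm_lt_one ((hu θ).trans_lt (by norm_num)), hκ]
  rw [e] at h
  convert h using 3
  simp [ContinuousMap.sum_apply]

/-- The Taylor series at `0` of an entire function converges locally uniformly on `ℂ`. -/
lemma tendsto_taylor_continuousMap {h : C(ℂ, ℂ)} (hd : Differentiable ℂ h) :
    ∃ c : ℕ → ℂ, Tendsto
      (fun N => ∑ q ∈ Finset.range N, c q • (ContinuousMap.id ℂ) ^ q) atTop (𝓝 h) := by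
  have hp := hd.hasFPowerSeriesOnBall 0 (R := 1) one_pos
  refine ⟨fun q => (cauchyPowerSeries h 0 1).coeff q, ?_⟩
  refine ContinuousMap.tendsto_of_tendstoLocallyUniformly ?_
  have := hp.tendstoLocallyUniformlyOn
  rw [Metric.eball_top, tendstoLocallyUniformlyOn_univ] at this
  simp only [zero_add] at this
  refine this.congr fun N z => ?_
  simp [FormalMultilinearSeries.partialSum, ContinuousMap.sum_apply, mul_comm]

namespace OmegaPaper

/-! ### Holomorphic functions on `Ω` in the two product charts -/

/-- The two charts of the sphere. Each point of `Ω` has both entries in the domain of the same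
one, and in either of them `Ω` is `{v | v.1 * v.2 ≠ 1}`. -/
def IsCoord (e : OpenPartialHomeomorph Sphere ℂ) : Prop := e = chartZero ∨ e = chartInf

lemma IsCoord.target {e : OpenPartialHomeomorph Sphere ℂ} (he : IsCoord e) :
    e.target = Set.univ := by
  rcases he with rfl | rfl <;> rfl

lemma IsCoord.mem_maximalAtlas {e : OpenPartialHomeomorph Sphere ℂ} (he : IsCoord e) :
    e ∈ IsManifold.maximalAtlas 𝓘(ℂ) ω Sphere :=
  IsManifold.subset_maximalAtlas he

lemma IsCoord.continuous_symm {e : OpenPartialHomeomorph Sphere ℂ} (he : IsCoord e) :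
    Continuous e.symm := by
  have := e.continuousOn_symm
  rwa [he.target, continuousOn_univ] at this

lemma IsCoord.symm_mem_source {e : OpenPartialHomeomorph Sphere ℂ} (he : IsCoord e) (z : ℂ) :
    e.symm z ∈ e.source :=
  e.map_target (by rw [he.target]; trivial)

lemma IsCoord.right_inv {e : OpenPartialHomeomorph Sphere ℂ} (he : IsCoord e) (z : ℂ) :
    e (e.symm z) = z :=
  e.right_inv (by rw [he.target]; trivial)

lemma IsCoord.mem_OmegaSet_iff {e : OpenPartialHomeomorph Sphere ℂ} (he : IsCoord e)
    {x : Sphere × Sphere} (h1 : x.1 ∈ e.source) (h2 : x.2 ∈ e.source) :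
    x ∈ OmegaSet ↔ e x.1 * e x.2 ≠ 1 := by
  rcases he with rfl | rfl
  · exact mem_OmegaSet_finite h1 h2
  · exact mem_OmegaSet_nonzero h1 h2

lemma IsCoord.symm_mem_OmegaSet_iff {e : OpenPartialHomeomorph Sphere ℂ} (he : IsCoord e)
    (v : ℂ × ℂ) : (e.symm v.1, e.symm v.2) ∈ OmegaSet ↔ v.1 * v.2 ≠ 1 := by
  rw [he.mem_OmegaSet_iff (he.symm_mem_source _) (he.symm_mem_source _), he.right_inv,
    he.right_inv]

lemma exists_isCoord (x : Omega) :
    ∃ e, IsCoord e ∧ x.1.1 ∈ e.source ∧ x.1.2 ∈ e.source := by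
  by_cases h : x.1.1 ≠ OnePoint.infty ∧ x.1.2 ≠ OnePoint.infty
  · exact ⟨chartZero, Or.inl rfl, h⟩
  · exact ⟨chartInf, Or.inr rfl, ne_zero_of_infty x.2 h⟩

lemma isOpen_mul_ne_one : IsOpen {v : ℂ × ℂ | v.1 * v.2 ≠ 1} :=
  isOpen_ne_fun (by fun_prop) (by fun_prop)

/-- The function on `ℂ × ℂ` that represents `f : Ω → ℂ` in the chart `e` of both factors, with the
value `0` where the point is outside `Ω`. -/
def inCoord (f : Omega → ℂ) (e : OpenPartialHomeomorph Sphere ℂ) (v : ℂ × ℂ) : ℂ :=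
  Function.extend Subtype.val f 0 (e.symm v.1, e.symm v.2)

lemma inCoord_apply (f : Omega → ℂ) {e : OpenPartialHomeomorph Sphere ℂ} {v : ℂ × ℂ} {x : Omega}
    (h : x.1 = (e.symm v.1, e.symm v.2)) : inCoord f e v = f x := by
  rw [inCoord, ← h]
  exact Subtype.val_injective.extend_apply f 0 x

lemma IsHolomorphic.differentiableOn_inCoord {f : Omega → ℂ} (hf : IsHolomorphic f)
    {e : OpenPartialHomeomorph Sphere ℂ} (he : IsCoord e) :
    DifferentiableOn ℂ (inCoord f e) {v | v.1 * v.2 ≠ 1} := by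
  intro v hv
  refine DifferentiableAt.differentiableWithinAt ?_
  rw [← mdifferentiableAt_iff_differentiableAt]
  set x : Omega := ⟨_, (he.symm_mem_OmegaSet_iff v).2 hv⟩ with hx
  have h1 : MDifferentiableAt (𝓘(ℂ).prod 𝓘(ℂ)) 𝓘(ℂ)
      (Function.extend Subtype.val f 0 : Sphere × Sphere → ℂ) x.1 := by
    refine (differentiableWithinAt_localInvariantProp.liftPropAt_iff_comp_subtype_val _ x).2 ?_
    rw [Function.extend_comp Subtype.val_injective]
    exact hf x
  have hs : ∀ z : ℂ, MDifferentiableAt 𝓘(ℂ) 𝓘(ℂ) e.symm z := fun z => by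
    have := contMDiffOn_symm_of_mem_maximalAtlas he.mem_maximalAtlas
    rw [he.target] at this
    exact (this.contMDiffAt univ_mem).mdifferentiableAt (by simp)
  have h2 : MDifferentiableAt 𝓘(ℂ, ℂ × ℂ) (𝓘(ℂ).prod 𝓘(ℂ))
      (fun v : ℂ × ℂ => (e.symm v.1, e.symm v.2)) v := by
    refine MDifferentiableAt.prodMk ?_ ?_
    · exact (hs v.1).comp v differentiableAt_fst.mdifferentiableAt
    · exact (hs v.2).comp v differentiableAt_snd.mdifferentiableAt
  exact h1.comp v h2

lemma isHolomorphic_of_differentiableOn_inCoord {f : Omega → ℂ}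
    (hf : ∀ e, IsCoord e → DifferentiableOn ℂ (inCoord f e) {v | v.1 * v.2 ≠ 1}) :
    IsHolomorphic f := by
  intro x
  obtain ⟨e, he, h1, h2⟩ := exists_isCoord x
  have hd := (hf e he).differentiableAt (x := (e x.1.1, e x.1.2))
    (isOpen_mul_ne_one.mem_nhds ((he.mem_OmegaSet_iff h1 h2).1 x.2))
  have := hd.mdifferentiableAt.comp x (mdifferentiableAt_pair
    (contMDiffAt_of_mem_maximalAtlas he.mem_maximalAtlas h1)
    (contMDiffAt_of_mem_maximalAtlas he.mem_maximalAtlas h2))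
  refine this.congr_of_eventuallyEq ?_
  have ho : IsOpen (e.source ×ˢ e.source) := e.open_source.prod e.open_source
  filter_upwards [(ho.preimage continuous_subtype_val).mem_nhds
    (show x.1 ∈ e.source ×ˢ e.source from ⟨h1, h2⟩)] with y hy
  refine (inCoord_apply f ?_).symm
  rw [e.left_inv hy.1, e.left_inv hy.2]

/-- A holomorphic function on `Ω` is holomorphic along every curve in `Ω` that is holomorphic in
one of the product charts. -/
lemma IsHolomorphic.differentiableAt_comp {f : Omega → ℂ} (hf : IsHolomorphic f)
    {e : OpenPartialHomeomorph Sphere ℂ} (he : IsCoord e) {g : ℂ → Omega} {p q : ℂ → ℂ} {t : ℂ}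
    (hp : DifferentiableAt ℂ p t) (hq : DifferentiableAt ℂ q t)
    (hg : ∀ᶠ s in 𝓝 t, (g s).1 = (e.symm (p s), e.symm (q s))) :
    DifferentiableAt ℂ (fun s => f (g s)) t := by
  have hmem : p t * q t ≠ 1 := by
    rw [← he.symm_mem_OmegaSet_iff (p t, q t), ← hg.self_of_nhds]
    exact (g t).2
  have h := ((hf.differentiableOn_inCoord he).differentiableAt
    (isOpen_mul_ne_one.mem_nhds (show (p t, q t) ∈ _ from hmem))).comp t (hp.prodMk hq)
  refine h.congr_of_eventuallyEq ?_
  filter_upwards [hg] with s hs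
  exact (inCoord_apply f (v := (p s, q s)) hs).symm

/-! ### The action of `ℂ \ {0}` on `Ω` -/

/-- Multiplication by `c` on the sphere, fixing `∞`. It is used for `c ≠ 0` only. -/
def scale (c : ℂ) (x : Sphere) : Sphere := x.elim OnePoint.infty (fun z => ((c * z : ℂ) : Sphere))

@[simp] lemma scale_coe (c z : ℂ) : scale c (z : Sphere) = ((c * z : ℂ) : Sphere) := rfl
@[simp] lemma scale_infty (c : ℂ) : scale c OnePoint.infty = OnePoint.infty := rfl

/-- In the charts `z` and `1 / z` the map `scale c` is multiplication by `c` and by `c⁻¹`. -/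
lemma IsCoord.exists_scale_symm {e : OpenPartialHomeomorph Sphere ℂ} (he : IsCoord e) :
    ∃ σ : ℂ → ℂ, DifferentiableOn ℂ σ {0}ᶜ ∧ (∀ c, c ≠ 0 → σ c ≠ 0) ∧ (∀ c, σ c⁻¹ = (σ c)⁻¹) ∧
      ∀ c, c ≠ 0 → ∀ z, scale c (e.symm z) = e.symm (σ c * z) := by
  rcases he with rfl | rfl
  · exact ⟨id, differentiableOn_id, fun c hc => hc, fun c => rfl, fun c hc z => rfl⟩
  · refine ⟨fun c => c⁻¹, differentiableOn_id.inv fun c hc => hc, fun c hc => inv_ne_zero hc,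
      fun c => rfl, fun c hc z => ?_⟩
    by_cases hz : z = 0
    · simp [coordInfSymm, hz]
    · simp [coordInfSymm, hz, hc, mul_comm]

lemma continuousAt_scale {c : ℂ} (hc : c ≠ 0) (x : Sphere) :
    ContinuousAt (fun p : ℂ × Sphere => scale p.1 p.2) (c, x) := by
  obtain ⟨e, he, hx⟩ : ∃ e, IsCoord e ∧ x ∈ e.source := by
    by_cases h : x = OnePoint.infty
    · exact ⟨chartInf, Or.inr rfl, by simp [h]⟩
    · exact ⟨chartZero, Or.inl rfl, h⟩
  obtain ⟨σ, hσ, -, -, hs⟩ := he.exists_scale_symm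
  have h1 : ContinuousAt (fun p : ℂ × Sphere => e.symm (σ p.1 * e p.2)) (c, x) := by
    refine he.continuous_symm.continuousAt.comp (ContinuousAt.mul ?_ ?_)
    · exact (hσ.differentiableAt (isOpen_compl_singleton.mem_nhds hc)).continuousAt.comp
        continuousAt_fst
    · exact (e.continuousAt hx).comp continuousAt_snd
  refine h1.congr ?_
  filter_upwards [(isOpen_compl_singleton.prod e.open_source).mem_nhds
    (show (c, x) ∈ ({0}ᶜ : Set ℂ) ×ˢ e.source from ⟨hc, hx⟩)] with p hp
  rw [← hs p.1 hp.1, e.left_inv hp.2]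

lemma scale_mem_OmegaSet {c : ℂ} (hc : c ≠ 0) (x : Omega) :
    (scale c x.1.1, scale c⁻¹ x.1.2) ∈ OmegaSet := by
  obtain ⟨e, he, h1, h2⟩ := exists_isCoord x
  obtain ⟨σ, -, hσ0, hσi, hs⟩ := he.exists_scale_symm
  have hx := (he.mem_OmegaSet_iff h1 h2).1 x.2
  rw [← e.left_inv h1, ← e.left_inv h2, hs c hc, hs _ (inv_ne_zero hc)]
  refine (he.symm_mem_OmegaSet_iff (σ c * e x.1.1, σ c⁻¹ * e x.1.2)).2 ?_
  have := hσ0 c hc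
  simp only [hσi]
  convert hx using 1
  field_simp

/-- The action `(z, w) ↦ (c z, c⁻¹ w)` of `c ≠ 0` on `Ω`; for `c = 0` it is the identity. -/
def rot (c : ℂ) (x : Omega) : Omega :=
  open Classical in if hc : c = 0 then x else ⟨_, scale_mem_OmegaSet hc x⟩

lemma rot_val {c : ℂ} (hc : c ≠ 0) (x : Omega) :
    (rot c x).1 = (scale c x.1.1, scale c⁻¹ x.1.2) := by
  simp [rot, hc]

lemma scale_scale (c d : ℂ) (x : Sphere) : scale c (scale d x) = scale (c * d) x := by
  induction x using OnePoint.rec with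
  | infty => rfl
  | coe z => simp [mul_assoc]

lemma rot_rot {c d : ℂ} (hc : c ≠ 0) (hd : d ≠ 0) (x : Omega) :
    rot c (rot d x) = rot (c * d) x := by
  apply Subtype.ext
  rw [rot_val hc, rot_val hd, rot_val (mul_ne_zero hc hd)]
  simp only [scale_scale, mul_inv]

lemma rot_one (x : Omega) : rot 1 x = x := by
  apply Subtype.ext
  rw [rot_val one_ne_zero, inv_one]
  have : ∀ y : Sphere, scale 1 y = y := fun y => by
    induction y using OnePoint.rec with
    | infty => rfl
    | coe z => simp
  simp only [this]

lemma continuousAt_rot {c : ℂ} (hc : c ≠ 0) (x : Omega) :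
    ContinuousAt (fun p : ℂ × Omega => rot p.1 p.2) (c, x) := by
  rw [IsInducing.subtypeVal.continuousAt_iff]
  have h1 : ContinuousAt (fun p : ℂ × Omega => (scale p.1 p.2.1.1, scale p.1⁻¹ p.2.1.2)) (c, x) := by
    refine ContinuousAt.prodMk ?_ ?_
    · exact (continuousAt_scale hc x.1.1).comp
        (f := fun p : ℂ × Omega => (p.1, p.2.1.1)) (x := (c, x)) (by fun_prop)
    · refine (continuousAt_scale (inv_ne_zero hc) x.1.2).comp
        (f := fun p : ℂ × Omega => (p.1⁻¹, p.2.1.2)) (x := (c, x)) ?_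
      exact ((continuousAt_inv₀ hc).comp continuousAt_fst).prodMk (by fun_prop)
  refine h1.congr ?_
  filter_upwards [(isOpen_compl_singleton.preimage continuous_fst).mem_nhds
    (show (c, x) ∈ Prod.fst ⁻¹' ({0}ᶜ : Set ℂ) from hc)] with p hp
  exact (rot_val hp p.2).symm

/-- Holomorphic functions are holomorphic along the orbits of the action. -/
lemma IsHolomorphic.differentiableOn_rot {f : Omega → ℂ} (hf : IsHolomorphic f) (x : Omega) :
    DifferentiableOn ℂ (fun c => f (rot c x)) {0}ᶜ := by
  intro c hc
  obtain ⟨e, he, h1, h2⟩ := exists_isCoord x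
  obtain ⟨σ, hσ, hσ0, hσi, hs⟩ := he.exists_scale_symm
  have hσc := hσ.differentiableAt (isOpen_compl_singleton.mem_nhds hc)
  refine (hf.differentiableAt_comp he (p := fun c => σ c * e x.1.1)
    (q := fun c => (σ c)⁻¹ * e x.1.2) (hσc.mul_const _)
    ((hσc.fun_inv (hσ0 c hc)).mul_const _) ?_).differentiableWithinAt
  filter_upwards [isOpen_compl_singleton.mem_nhds hc] with s hs0
  rw [rot_val hs0, ← hσi, ← hs s hs0, ← hs _ (inv_ne_zero hs0), e.left_inv h1, e.left_inv h2]

/-! ### The functions `f_{p,q}` and the two sections of the action -/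

lemma basisFun_add_left (n q : ℕ) (x : Omega) :
    basisFun (q + n) q x = basisFun 1 0 x ^ n * basisFun 1 1 x ^ q := by
  simp only [basisFun]
  split_ifs
  · simp only [Nat.le_add_right, sup_of_le_left, zero_le, pow_zero, pow_one, mul_one, max_self,
      div_pow, mul_pow, pow_add, div_mul_div_comm]
    ring
  · simp only [Nat.le_add_right, sup_of_le_left, zero_le, pow_zero, pow_one, max_self, tsub_self,
      tsub_zero, add_tsub_cancel_left, div_pow, pow_add, div_mul_div_comm, one_mul, one_pow]
    ring

lemma basisFun_add_right (n p : ℕ) (x : Omega) :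
    basisFun p (p + n) x = basisFun 0 1 x ^ n * basisFun 1 1 x ^ p := by
  simp only [basisFun]
  split_ifs
  · simp only [Nat.le_add_right, sup_of_le_right, zero_le, pow_zero, pow_one, one_mul, max_self,
      div_pow, mul_pow, pow_add, div_mul_div_comm]
    ring
  · simp only [Nat.le_add_right, sup_of_le_right, zero_le, pow_zero, pow_one, max_self, tsub_self,
      tsub_zero, add_tsub_cancel_left, div_pow, pow_add, div_mul_div_comm, mul_one, one_pow]
    ring

lemma rot_finite_iff {c : ℂ} (hc : c ≠ 0) (x : Omega) :
    ((rot c x).1.1 ≠ OnePoint.infty ∧ (rot c x).1.2 ≠ OnePoint.infty) ↔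
      (x.1.1 ≠ OnePoint.infty ∧ x.1.2 ≠ OnePoint.infty) := by
  have : ∀ (d : ℂ) (y : Sphere), scale d y ≠ OnePoint.infty ↔ y ≠ OnePoint.infty := fun d y => by
    induction y using OnePoint.rec with
    | infty => rfl
    | coe z => simp
  rw [rot_val hc]
  simp only [this]

lemma coordZero_scale (c : ℂ) (x : Sphere) : coordZero (scale c x) = c * coordZero x := by
  induction x using OnePoint.rec with
  | infty => simp
  | coe z => simp

lemma coordInf_scale (c : ℂ) (x : Sphere) : coordInf (scale c x) = c⁻¹ * coordInf x := by
  induction x using OnePoint.rec with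
  | infty => simp
  | coe z => simp [mul_comm]

/-- The function `f_{p,q}` is homogeneous of degree `p - q` under the action. -/
lemma basisFun_rot {c : ℂ} (hc : c ≠ 0) (p q : ℕ) (x : Omega) :
    basisFun p q (rot c x) = c ^ ((p : ℤ) - q) * basisFun p q x := by
  have e0 : c * coordZero x.1.1 * (c⁻¹ * coordZero x.1.2) =
      coordZero x.1.1 * coordZero x.1.2 := by field_simp
  have e1 : c⁻¹ * coordInf x.1.1 * (c * coordInf x.1.2) =
      coordInf x.1.1 * coordInf x.1.2 := by field_simp
  by_cases h : x.1.1 ≠ OnePoint.infty ∧ x.1.2 ≠ OnePoint.infty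
  · rw [basisFun, if_pos ((rot_finite_iff hc x).2 h), basisFun, if_pos h, rot_val hc]
    simp only [coordZero_scale, e0]
    rw [zpow_sub₀ hc, mul_pow, mul_pow, zpow_natCast, zpow_natCast, inv_pow]
    ring
  · rw [basisFun, if_neg (mt (rot_finite_iff hc x).1 h), basisFun, if_neg h, rot_val hc]
    have e2 : (p : ℤ) - q = ((max p q - q : ℕ) : ℤ) - ((max p q - p : ℕ) : ℤ) := by omega
    simp only [coordInf_scale, inv_inv, e1]
    rw [e2, zpow_sub₀ hc, mul_pow, mul_pow, zpow_natCast, zpow_natCast, inv_pow]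
    ring

lemma sphereMul_coordInfSymm_ne_one (t : ℂ) :
    sphereMul (coordInfSymm (1 + t)) (t : Sphere) ≠ (1 : ℂ) ∧
    sphereMul (t : Sphere) (coordInfSymm (1 + t)) ≠ (1 : ℂ) := by
  by_cases h : 1 + t = 0
  · have ht : t ≠ 0 := by rintro rfl; simp at h
    simp [coordInfSymm, h, sphereMul, ht]
  · have h1 : (1 + t)⁻¹ * t ≠ 1 := fun h2 => by
      have h3 : t = 1 + t := by field_simp at h2; exact h2
      simp at h3
    have h2 : t * (1 + t)⁻¹ ≠ 1 := by rwa [mul_comm]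
    simp only [coordInfSymm, h, if_false, sphereMul]
    exact ⟨fun h3 => h1 (OnePoint.coe_injective h3), fun h3 => h2 (OnePoint.coe_injective h3)⟩

/-- The curve `t ↦ (1 / (1 + t), t)` in `Ω`. It meets exactly once each orbit of the action on
which `f_{1,0}` has no zero, in the point where `f_{1,0} = 1` and `f_{1,1} = t`. -/
def sectionLeft (t : ℂ) : Omega := ⟨(coordInfSymm (1 + t), (t : Sphere)),
  (sphereMul_coordInfSymm_ne_one t).1⟩

/-- The curve `t ↦ (t, 1 / (1 + t))` in `Ω`, which is to `f_{0,1}` what `sectionLeft` is to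
`f_{1,0}`. -/
def sectionRight (t : ℂ) : Omega := ⟨((t : Sphere), coordInfSymm (1 + t)),
  (sphereMul_coordInfSymm_ne_one t).2⟩

lemma IsHolomorphic.differentiable_sectionLeft {f : Omega → ℂ} (hf : IsHolomorphic f) :
    Differentiable ℂ fun t => f (sectionLeft t) := by
  intro t
  by_cases h : t = 0
  · subst h
    refine hf.differentiableAt_comp (Or.inl rfl) (p := fun t => (1 + t)⁻¹) (q := id)
      (DifferentiableAt.inv (by fun_prop) (by simp)) differentiableAt_id ?_
    have : ∀ᶠ s : ℂ in 𝓝 0, 1 + s ≠ 0 :=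
      ContinuousAt.eventually_ne (by fun_prop) (by simp)
    filter_upwards [this] with s hs
    simp [sectionLeft, coordInfSymm, hs]
  · refine hf.differentiableAt_comp (Or.inr rfl) (p := fun t => 1 + t) (q := fun t => t⁻¹)
      (by fun_prop) (differentiableAt_inv h) ?_
    filter_upwards [isOpen_ne.mem_nhds h] with s hs
    simp [sectionLeft, coordInfSymm, show s ≠ 0 from hs]

lemma IsHolomorphic.differentiable_sectionRight {f : Omega → ℂ} (hf : IsHolomorphic f) :
    Differentiable ℂ fun t => f (sectionRight t) := by
  intro t
  by_cases h : t = 0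
  · subst h
    refine hf.differentiableAt_comp (Or.inl rfl) (p := id) (q := fun t => (1 + t)⁻¹)
      differentiableAt_id (DifferentiableAt.inv (by fun_prop) (by simp)) ?_
    have : ∀ᶠ s : ℂ in 𝓝 0, 1 + s ≠ 0 :=
      ContinuousAt.eventually_ne (by fun_prop) (by simp)
    filter_upwards [this] with s hs
    simp [sectionRight, coordInfSymm, hs]
  · refine hf.differentiableAt_comp (Or.inr rfl) (p := fun t => t⁻¹) (q := fun t => 1 + t)
      (differentiableAt_inv h) (by fun_prop) ?_
    filter_upwards [isOpen_ne.mem_nhds h] with s hs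
    simp [sectionRight, coordInfSymm, show s ≠ 0 from hs]

lemma one_add_div_one_sub {z w : ℂ} (h : 1 - z * w ≠ 0) :
    1 + z * w / (1 - z * w) = (1 - z * w)⁻¹ := by
  field_simp
  ring

lemma rot_sectionLeft {x : Omega} (hx : basisFun 1 0 x ≠ 0) :
    rot (basisFun 1 0 x) (sectionLeft (basisFun 1 1 x)) = x := by
  apply Subtype.ext
  rw [rot_val hx]
  obtain ⟨⟨a, b⟩, hab⟩ := x
  induction b using OnePoint.rec with
  | infty => simp [basisFun] at hx
  | coe w =>
    induction a using OnePoint.rec with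
    | infty => simp [basisFun, sectionLeft, coordInfSymm]
    | coe z =>
      have hzw : 1 - z * w ≠ 0 := sub_ne_zero.2 ((coe_mem_OmegaSet z w).1 hab).symm
      have hz : z ≠ 0 := by
        rintro rfl
        simp [basisFun] at hx
      simp [basisFun, sectionLeft, coordInfSymm, one_add_div_one_sub hzw, hzw]
      field_simp

lemma rot_sectionRight {x : Omega} (hx : basisFun 0 1 x ≠ 0) :
    rot (basisFun 0 1 x)⁻¹ (sectionRight (basisFun 1 1 x)) = x := by
  apply Subtype.ext
  rw [rot_val (inv_ne_zero hx), inv_inv]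
  obtain ⟨⟨a, b⟩, hab⟩ := x
  induction a using OnePoint.rec with
  | infty => simp [basisFun] at hx
  | coe z =>
    induction b using OnePoint.rec with
    | infty => simp [basisFun, sectionRight, coordInfSymm]
    | coe w =>
      have hzw : 1 - z * w ≠ 0 := sub_ne_zero.2 ((coe_mem_OmegaSet z w).1 hab).symm
      have hw : w ≠ 0 := by
        rintro rfl
        simp [basisFun] at hx
      simp [basisFun, sectionRight, coordInfSymm, one_add_div_one_sub hzw, hzw]
      field_simp

lemma dense_finite_nonzero :
    Dense {x : Omega | x.1.1 ≠ ((0 : ℂ) : Sphere) ∧ x.1.2 ≠ OnePoint.infty} ∧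
    Dense {x : Omega | x.1.1 ≠ OnePoint.infty ∧ x.1.2 ≠ ((0 : ℂ) : Sphere)} := by
  have h0 : Dense ({((0 : ℂ) : Sphere)}ᶜ : Set Sphere) := dense_compl_singleton _
  have h1 : Dense ({OnePoint.infty}ᶜ : Set Sphere) := dense_compl_singleton _
  have ho : IsOpenMap (Subtype.val : Omega → Sphere × Sphere) :=
    isOpen_OmegaSet.isOpenMap_subtype_val
  exact ⟨(h0.prod h1).preimage ho, (h1.prod h0).preimage ho⟩

lemma dense_basisFun_left_ne_zero : Dense {x : Omega | basisFun 1 0 x ≠ 0} := by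
  refine dense_finite_nonzero.1.mono ?_
  rintro ⟨⟨a, b⟩, hab⟩ ⟨ha, hb⟩
  induction b using OnePoint.rec with
  | infty => exact absurd rfl hb
  | coe w =>
    induction a using OnePoint.rec with
    | infty =>
      have hw : w ≠ 0 := by
        have := (ne_zero_of_infty hab (by simp)).2
        simpa using this
      simp [basisFun, hw]
    | coe z =>
      have hzw : 1 - z * w ≠ 0 := sub_ne_zero.2 ((coe_mem_OmegaSet z w).1 hab).symm
      have hz : z ≠ 0 := by simpa using ha
      simp [basisFun, hz, hzw]

lemma dense_basisFun_right_ne_zero : Dense {x : Omega | basisFun 0 1 x ≠ 0} := by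
  refine dense_finite_nonzero.2.mono ?_
  rintro ⟨⟨a, b⟩, hab⟩ ⟨ha, hb⟩
  induction a using OnePoint.rec with
  | infty => exact absurd rfl ha
  | coe z =>
    induction b using OnePoint.rec with
    | infty =>
      have hz : z ≠ 0 := by
        have := (ne_zero_of_infty hab (by simp)).1
        simpa using this
      simp [basisFun, hz]
    | coe w =>
      have hzw : 1 - z * w ≠ 0 := sub_ne_zero.2 ((coe_mem_OmegaSet z w).1 hab).symm
      have hw : w ≠ 0 := by simpa using hb
      simp [basisFun, hw, hzw]

/-! ### Weighted averages over the circle action -/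

instance : LocallyCompactSpace Omega := isOpen_OmegaSet.locallyCompactSpace

lemma circleMap_ne_zero {R : ℝ} (hR : 0 < R) (θ : ℝ) : circleMap 0 R θ ≠ 0 :=
  circleMap_ne_center hR.ne'

/-- The map `(x, θ) ↦ rot (R e^{iθ}) x`. -/
def rotCircle {R : ℝ} (hR : 0 < R) : C(Omega × ℝ, Omega) where
  toFun p := rot (circleMap 0 R p.2) p.1
  continuous_toFun := continuous_iff_continuousAt.2 fun p =>
    (continuousAt_rot (circleMap_ne_zero hR p.2) p.1).comp
      (f := fun p : Omega × ℝ => (circleMap 0 R p.2, p.1)) (x := p)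
      (((continuous_circleMap 0 R).comp continuous_snd).prodMk continuous_fst).continuousAt

/-- The mean value over `[0, 2π]`, as a continuous function on `C(ℝ, ℂ)`. -/
def meanPeriod : C(C(ℝ, ℂ), ℂ) where
  toFun g := (2 * Real.pi)⁻¹ • ∫ θ in 0..2 * Real.pi, g θ
  continuous_toFun := by
    have h : Continuous (Function.uncurry fun (g : C(ℝ, ℂ)) (θ : ℝ) => g θ) := continuous_eval
    exact (intervalIntegral.continuous_parametric_intervalIntegral_of_continuous'
      (μ := MeasureTheory.volume) h 0 (2 * Real.pi)).const_smul (2 * Real.pi)⁻¹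

/-- The average of the functions `x ↦ f (rot (R e^{iθ}) x)`, weighted by `k θ`. -/
def average {R : ℝ} (hR : 0 < R) (k : C(ℝ, ℂ)) (f : C(Omega, ℂ)) : C(Omega, ℂ) :=
  meanPeriod.comp ((k.comp ContinuousMap.snd * f.comp (rotCircle hR)).curry)

lemma average_apply {R : ℝ} (hR : 0 < R) (k : C(ℝ, ℂ)) (f : C(Omega, ℂ)) (x : Omega) :
    average hR k f x = (2 * Real.pi)⁻¹ •
      ∫ θ in 0..2 * Real.pi, k θ * f (rot (circleMap 0 R θ) x) := rfl

lemma average_eq_circleAverage {R : ℝ} (hR : 0 < R) {k : C(ℝ, ℂ)} {K : ℂ → ℂ}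
    (hk : ∀ θ, k θ = K (circleMap 0 R θ)) (f : C(Omega, ℂ)) (x : Omega) :
    average hR k f x = Real.circleAverage (fun z => K z * f (rot z x)) 0 R := by
  simp only [average_apply, hk, Real.circleAverage_def]

lemma continuous_average {R : ℝ} (hR : 0 < R) :
    Continuous fun p : C(ℝ, ℂ) × C(Omega, ℂ) => average hR p.1 p.2 := by
  refine (ContinuousMap.continuous_postcomp _).comp (ContinuousMap.continuous_curry.comp ?_)
  exact ((ContinuousMap.continuous_precomp _).comp continuous_fst).mul
    ((ContinuousMap.continuous_precomp _).comp continuous_snd)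

lemma intervalIntegrable_average {R : ℝ} (hR : 0 < R) (k : C(ℝ, ℂ)) (f : C(Omega, ℂ)) (x : Omega) :
    IntervalIntegrable (fun θ => k θ * f (rot (circleMap 0 R θ) x)) MeasureTheory.volume
      0 (2 * Real.pi) :=
  (k.continuous.mul (f.continuous.comp ((rotCircle hR).continuous.comp
    (Continuous.prodMk_right x)))).intervalIntegrable _ _

/-- The weighted average as a bilinear map in the weight and the function. -/
def averageBilin {R : ℝ} (hR : 0 < R) : C(ℝ, ℂ) →ₗ[ℂ] C(Omega, ℂ) →ₗ[ℂ] C(Omega, ℂ) :=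
  LinearMap.mk₂ ℂ (average hR)
    (fun k l f => by
      ext x
      simp only [ContinuousMap.add_apply, average_apply, add_mul, ← smul_add]
      rw [intervalIntegral.integral_add (intervalIntegrable_average hR k f x)
        (intervalIntegrable_average hR l f x)])
    (fun c k f => by
      ext x
      simp only [ContinuousMap.smul_apply, average_apply, smul_eq_mul, mul_assoc]
      rw [intervalIntegral.integral_const_mul, mul_smul_comm])
    (fun k f g => by
      ext x
      simp only [ContinuousMap.add_apply, average_apply, mul_add, ← smul_add]
      rw [intervalIntegral.integral_add (intervalIntegrable_average hR k f x)
        (intervalIntegrable_average hR k g x)])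
    (fun c k f => by
      ext x
      simp only [ContinuousMap.smul_apply, average_apply, smul_eq_mul, mul_left_comm _ c]
      rw [intervalIntegral.integral_const_mul, mul_smul_comm])

lemma isHolomorphic_average {R : ℝ} (hR : 0 < R) (k : C(ℝ, ℂ)) {f : C(Omega, ℂ)}
    (hf : IsHolomorphic f) : IsHolomorphic (average hR k f) := by
  refine isHolomorphic_of_differentiableOn_inCoord fun e he => ?_
  obtain ⟨σ, hσ, hσ0, hσi, hs⟩ := he.exists_scale_symm
  have hγ0 := circleMap_ne_zero hR
  have hγ : Continuous fun θ : ℝ => σ (circleMap 0 R θ) :=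
    hσ.continuousOn.comp_continuous (continuous_circleMap 0 R) hγ0
  have hγi : Continuous fun θ : ℝ => (σ (circleMap 0 R θ))⁻¹ := hγ.inv₀ fun θ => hσ0 _ (hγ0 θ)
  have hd := hf.differentiableOn_inCoord he
  have hmaps : ∀ θ : ℝ, ∀ v ∈ {v : ℂ × ℂ | v.1 * v.2 ≠ 1},
      (σ (circleMap 0 R θ) * v.1, (σ (circleMap 0 R θ))⁻¹ * v.2) ∈
        {v : ℂ × ℂ | v.1 * v.2 ≠ 1} := by
    intro θ v hv
    have := hσ0 _ (hγ0 θ)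
    simp only [Set.mem_ofPred_eq] at hv ⊢
    convert hv using 1
    field_simp
  have key := differentiableOn_intervalIntegral_of_continuousOn (E := ℂ × ℂ)
    (G := fun v θ => k θ * inCoord f e (σ (circleMap 0 R θ) * v.1, (σ (circleMap 0 R θ))⁻¹ * v.2))
    (D := {v | v.1 * v.2 ≠ 1}) isOpen_mul_ne_one ?_ ?_ Real.two_pi_pos.le
  · refine (key.const_smul (2 * Real.pi)⁻¹).congr fun v hv => ?_
    have hx := (he.symm_mem_OmegaSet_iff v).2 hv
    rw [inCoord_apply (x := ⟨_, hx⟩) _ rfl, average_apply]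
    congr 2 with θ
    congr 1
    refine (inCoord_apply f ?_).symm
    simp only [rot_val (hγ0 θ), hs _ (hγ0 θ), hs _ (inv_ne_zero (hγ0 θ)), hσi]
  · refine ContinuousOn.mul (by fun_prop) ?_
    refine hd.continuousOn.comp (Continuous.continuousOn ?_) fun p hp => hmaps p.2 p.1 hp.1
    exact ((hγ.comp continuous_snd).mul (by fun_prop)).prodMk
      ((hγi.comp continuous_snd).mul (by fun_prop))
  · intro θ
    refine DifferentiableOn.const_mul (hd.comp (Differentiable.differentiableOn ?_) (hmaps θ)) _
    fun_prop

/-- The weighted average as a continuous linear operator on the holomorphic functions on `Ω`. -/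
def averageHol {R : ℝ} (hR : 0 < R) (k : C(ℝ, ℂ)) : HOmega →L[ℂ] HOmega where
  toLinearMap := ((averageBilin hR k).domRestrict holSubmodule).codRestrict holSubmodule
    fun f => isHolomorphic_average hR k f.2
  cont := Continuous.subtype_mk
    ((continuous_average hR).comp (continuous_const.prodMk continuous_subtype_val)) _

lemma averageHol_sum {R : ℝ} (hR : 0 < R) {ι : Type*} (s : Finset ι) (k : ι → C(ℝ, ℂ))
    (f : HOmega) : averageHol hR (∑ i ∈ s, k i) f = ∑ i ∈ s, averageHol hR (k i) f := by
  have h : averageHol hR (∑ i ∈ s, k i) f =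
      ((averageBilin hR).flip f.1).codRestrict holSubmodule
        (fun k => isHolomorphic_average hR k f.2) (∑ i ∈ s, k i) := rfl
  rw [h, map_sum]
  rfl

lemma continuous_averageHol_left {R : ℝ} (hR : 0 < R) (f : HOmega) :
    Continuous fun k => averageHol hR k f :=
  Continuous.subtype_mk ((continuous_average hR).comp (continuous_id.prodMk continuous_const)) _

/-! ### Homogeneous components -/

/-- The function `θ ↦ (R e^{iθ}) ^ n`. -/
def circlePow {R : ℝ} (hR : 0 < R) (n : ℤ) : C(ℝ, ℂ) where
  toFun θ := circleMap 0 R θ ^ n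
  continuous_toFun :=
    (continuous_circleMap 0 R).zpow₀ n fun θ => Or.inl (circleMap_ne_zero hR θ)

lemma averageHol_circlePow_apply {R : ℝ} (hR : 0 < R) (n : ℤ) (f : HOmega) (x : Omega) :
    averageHol hR (circlePow hR n) f x =
      Real.circleAverage (fun z => z ^ n * f (rot z x)) 0 R :=
  average_eq_circleAverage hR (K := fun z => z ^ n) (fun _ => rfl) f.1 x

/-- The average with weight `(R e^{iθ}) ^ (-n)` is homogeneous of degree `n` under the action of
all of `ℂ \ {0}`: by Cauchy's theorem it does not depend on the circle. -/
lemma averageHol_circlePow_rot {R : ℝ} (hR : 0 < R) (n : ℤ) (f : HOmega) {μ : ℂ} (hμ : μ ≠ 0)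
    (x : Omega) :
    averageHol hR (circlePow hR (-n)) f (rot μ x) =
      μ ^ n * averageHol hR (circlePow hR (-n)) f x := by
  have hg : DifferentiableOn ℂ (fun z => z ^ (-n) * f (rot z x)) {0}ᶜ := by
    refine DifferentiableOn.mul (fun z hz => ?_) (f.isHolomorphic.differentiableOn_rot x)
    exact (differentiableAt_zpow.2 (Or.inl hz)).differentiableWithinAt
  rw [averageHol_circlePow_apply, averageHol_circlePow_apply,
    ← circleAverage_comp_mul_right hg hR hμ, ← smul_eq_mul, ← Real.circleAverage_fun_smul]
  refine Real.circleAverage_congr_sphere fun z hz => ?_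
  have hz0 : z ≠ 0 := by
    rintro rfl
    simp at hz
    exact hR.ne' (abs_eq_zero.1 hz.symm)
  simp only [smul_eq_mul, rot_rot hz0 hμ, mul_zpow]
  have : μ ^ n * μ ^ (-n) = 1 := by rw [← zpow_add₀ hμ]; simp
  linear_combination (-(z ^ (-n) * f (rot (z * μ) x))) * this

lemma basisElt_apply (p q : ℕ) (x : Omega) : basisElt p q x = basisFun p q x := rfl

lemma averageHol_circlePow_basisElt {R : ℝ} (hR : 0 < R) {n : ℤ} {p q : ℕ}
    (hn : n + ((p : ℤ) - q) ≠ 0) : averageHol hR (circlePow hR n) (basisElt p q) = 0 := by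
  refine DFunLike.ext _ _ fun x => ?_
  rw [averageHol_circlePow_apply]
  have h : Real.circleAverage (fun z => z ^ n * basisElt p q (rot z x)) 0 R =
      Real.circleAverage (fun z => basisFun p q x • z ^ (n + ((p : ℤ) - q))) 0 R := by
    refine Real.circleAverage_congr_sphere fun z hz => ?_
    have hz0 : z ≠ 0 := by
      rintro rfl
      simp at hz
      exact hR.ne' (abs_eq_zero.1 hz.symm)
    simp only [basisElt_apply, basisFun_rot hz0, smul_eq_mul, zpow_add₀ hz0 n]
    ring
  rw [h, Real.circleAverage_fun_smul, circleAverage_zpow_eq_zero hn hR, smul_zero]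
  rfl

/-- The underlying continuous function, as a linear map. -/
def toContinuousMap : HOmega →ₗ[ℂ] C(Omega, ℂ) := holSubmodule.subtype

lemma toContinuousMap_apply (f : HOmega) (x : Omega) : toContinuousMap f x = f x := rfl

lemma isInducing_toContinuousMap : IsInducing toContinuousMap := IsInducing.subtypeVal

/-- If `F = E ^ n * h(f_{1,1})` with `h` entire wherever `E` does not vanish, then the Taylor
series of `h` expands `F` into the functions `E ^ n * f_{1,1} ^ q`, locally uniformly. -/
lemma mem_topologicalClosure_span {S : Set HOmega} {F : HOmega} {n : ℕ} {E : HOmega}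
    (hE : Dense {x : Omega | E x ≠ 0}) {h : C(ℂ, ℂ)} (hd : Differentiable ℂ h)
    (hF : ∀ x, E x ≠ 0 → F x = E x ^ n * h (basisFun 1 1 x))
    (hS : ∀ q : ℕ, ∃ g ∈ S, ∀ x, g x = E x ^ n * basisFun 1 1 x ^ q) :
    F ∈ (Submodule.span ℂ S).topologicalClosure := by
  choose g hgS hg using hS
  obtain ⟨c, hc⟩ := tendsto_taylor_continuousMap hd
  -- Both sides are continuous, so the formula for `F` persists at the zeros of `E`.
  have hF' : toContinuousMap F = toContinuousMap E ^ n * h.comp (toContinuousMap (basisElt 1 1)) :=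
    DFunLike.coe_injective (Continuous.ext_on hE (ContinuousMap.continuous _)
      (ContinuousMap.continuous _) hF)
  have hcont : Continuous fun φ : C(ℂ, ℂ) =>
      toContinuousMap E ^ n * φ.comp (toContinuousMap (basisElt 1 1)) :=
    continuous_const.mul (ContinuousMap.continuous_precomp _)
  have hlim : Tendsto (fun N => ∑ q ∈ Finset.range N, c q • g q) atTop (𝓝 F) := by
    refine isInducing_toContinuousMap.tendsto_nhds_iff.2 ?_
    rw [hF']
    refine ((hcont.tendsto h).comp hc).congr fun N => ?_
    ext x
    simp only [Function.comp_apply, map_sum, map_smul, ContinuousMap.sum_apply,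
      ContinuousMap.mul_apply, ContinuousMap.comp_apply, ContinuousMap.smul_apply,
      ContinuousMap.pow_apply, ContinuousMap.id_apply, toContinuousMap_apply, basisElt_apply, hg,
      Finset.mul_sum, smul_eq_mul]
    exact Finset.sum_congr rfl fun q _ => mul_left_comm _ _ _
  refine mem_closure_of_tendsto hlim (Eventually.of_forall fun N => ?_)
  exact Submodule.sum_mem _ fun q _ => Submodule.smul_mem _ _ (Submodule.subset_span (hgS q))

/-- The components of degree `n ≥ 0` of a holomorphic function belong to the past. -/
lemma averageHol_circlePow_mem_past {R : ℝ} (hR : 0 < R) (n : ℕ) (f : HOmega) :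
    averageHol hR (circlePow hR (-(n : ℤ))) f ∈ past := by
  set F := averageHol hR (circlePow hR (-(n : ℤ))) f
  have hd := F.isHolomorphic.differentiable_sectionLeft
  refine mem_topologicalClosure_span (E := basisElt 1 0) (n := n) dense_basisFun_left_ne_zero
    (h := ⟨_, hd.continuous⟩) hd (fun x hx => ?_) fun q =>
      ⟨basisElt (q + n) q, ⟨q + n, q, by omega, rfl⟩, basisFun_add_left n q⟩
  have := averageHol_circlePow_rot hR n f hx (sectionLeft (basisFun 1 1 x))
  rw [zpow_natCast] at this
  conv_lhs => rw [← rot_sectionLeft hx]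
  exact this

/-- The components of degree `-n < 0` of a holomorphic function belong to the future. -/
lemma averageHol_circlePow_mem_future {R : ℝ} (hR : 0 < R) {n : ℕ} (hn : 0 < n) (f : HOmega) :
    averageHol hR (circlePow hR (n : ℤ)) f ∈ future := by
  set F := averageHol hR (circlePow hR (n : ℤ)) f
  have hd := F.isHolomorphic.differentiable_sectionRight
  refine mem_topologicalClosure_span (E := basisElt 0 1) (n := n) dense_basisFun_right_ne_zero
    (h := ⟨_, hd.continuous⟩) hd (fun x hx => ?_) fun p =>
      ⟨basisElt p (p + n), ⟨p, p + n, by omega, rfl⟩, basisFun_add_right n p⟩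
  have := averageHol_circlePow_rot hR (-(n : ℤ)) f (inv_ne_zero hx)
    (sectionRight (basisFun 1 1 x))
  rw [zpow_neg, zpow_natCast, inv_pow, inv_inv, neg_neg] at this
  conv_lhs => rw [← rot_sectionRight hx]
  exact this

/-! ### The two projections -/

lemma two_pos_real : (0 : ℝ) < 2 := two_pos
lemma half_pos_real : (0 : ℝ) < 2⁻¹ := by norm_num

lemma norm_circleMap_two_inv (θ : ℝ) : ‖(circleMap 0 2 θ)⁻¹‖ = 1 / 2 := by
  simp [norm_circleMap_zero]

lemma norm_circleMap_half (θ : ℝ) : ‖circleMap 0 2⁻¹ θ‖ = 1 / 2 := by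
  simp [norm_circleMap_zero]

lemma one_sub_ne_zero_of_norm {u : ℂ} (hu : ‖u‖ = 1 / 2) : 1 - u ≠ 0 := by
  intro h
  rw [← sub_eq_zero.1 h, norm_one] at hu
  norm_num at hu

/-- The Cauchy kernel `λ / (λ - 1) = 1 / (1 - λ⁻¹)` on the circle `|λ| = 2`. -/
def cauchyOuter : C(ℝ, ℂ) where
  toFun θ := (1 - (circleMap 0 2 θ)⁻¹)⁻¹
  continuous_toFun := (continuous_const.sub ((continuous_circleMap 0 2).inv₀
    (circleMap_ne_zero two_pos_real))).inv₀
      fun θ => one_sub_ne_zero_of_norm (norm_circleMap_two_inv θ)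

/-- The negative `λ / (1 - λ)` of the Cauchy kernel on the circle `|λ| = 1 / 2`. -/
def cauchyInner : C(ℝ, ℂ) where
  toFun θ := circleMap 0 2⁻¹ θ * (1 - circleMap 0 2⁻¹ θ)⁻¹
  continuous_toFun := (continuous_circleMap 0 _).mul ((continuous_const.sub
    (continuous_circleMap 0 _)).inv₀ fun θ => one_sub_ne_zero_of_norm (norm_circleMap_half θ))

lemma tendsto_cauchyOuter :
    Tendsto (fun N => ∑ n ∈ Finset.range N, circlePow two_pos_real (-(n : ℤ))) atTop
      (𝓝 cauchyOuter) := by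
  have h := tendsto_sum_pow_continuousMap (u := circlePow two_pos_real (-1)) (κ := cauchyOuter)
    (fun θ => by
      have := norm_circleMap_two_inv θ
      simp only [circlePow, ContinuousMap.coe_mk, zpow_neg_one, this, le_refl])
    (fun θ => by simp [circlePow, cauchyOuter])
  refine h.congr fun N => Finset.sum_congr rfl fun n _ => ?_
  ext θ
  simp [circlePow]

lemma tendsto_cauchyInner :
    Tendsto (fun N => ∑ n ∈ Finset.range N, circlePow half_pos_real ((n + 1 : ℕ) : ℤ)) atTop
      (𝓝 cauchyInner) := by
  set κ : C(ℝ, ℂ) := ⟨fun θ => (1 - circleMap 0 2⁻¹ θ)⁻¹, (continuous_const.sub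
    (continuous_circleMap 0 _)).inv₀ fun θ => one_sub_ne_zero_of_norm (norm_circleMap_half θ)⟩
  have h := tendsto_sum_pow_continuousMap (u := circlePow half_pos_real 1) (κ := κ)
    (fun θ => by
      have := norm_circleMap_half θ
      simp only [circlePow, ContinuousMap.coe_mk, zpow_one, this, le_refl])
    (fun θ => by simp [circlePow, κ])
  have h2 := h.const_mul (circlePow half_pos_real 1)
  have e : circlePow half_pos_real 1 * κ = cauchyInner := by
    ext θ
    simp [circlePow, κ, cauchyInner]
  rw [e] at h2
  refine h2.congr fun N => ?_
  rw [Finset.mul_sum]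
  refine Finset.sum_congr rfl fun n _ => ?_
  ext θ
  simp only [circlePow, ContinuousMap.mul_apply, ContinuousMap.coe_mk, ContinuousMap.pow_apply,
    zpow_one, zpow_natCast]
  ring

/-- The projection onto the past: the sum of the components of degree `n ≥ 0`. -/
def projPast : HOmega →L[ℂ] HOmega := averageHol two_pos_real cauchyOuter

/-- The projection onto the future: the sum of the components of degree `n < 0`. -/
def projFuture : HOmega →L[ℂ] HOmega := averageHol half_pos_real cauchyInner

lemma tendsto_projPast (f : HOmega) :
    Tendsto (fun N => ∑ n ∈ Finset.range N,
      averageHol two_pos_real (circlePow two_pos_real (-(n : ℤ))) f) atTop (𝓝 (projPast f)) := by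
  refine (((continuous_averageHol_left two_pos_real f).tendsto _).comp
    tendsto_cauchyOuter).congr fun N => ?_
  exact averageHol_sum _ _ _ _

lemma tendsto_projFuture (f : HOmega) :
    Tendsto (fun N => ∑ n ∈ Finset.range N,
      averageHol half_pos_real (circlePow half_pos_real ((n + 1 : ℕ) : ℤ)) f) atTop
      (𝓝 (projFuture f)) := by
  refine (((continuous_averageHol_left half_pos_real f).tendsto _).comp
    tendsto_cauchyInner).congr fun N => ?_
  exact averageHol_sum _ _ _ _

lemma isClosed_past : IsClosed (past : Set HOmega) := Submodule.isClosed_topologicalClosure _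

lemma isClosed_future : IsClosed (future : Set HOmega) := Submodule.isClosed_topologicalClosure _

lemma projPast_mem (f : HOmega) : projPast f ∈ past :=
  isClosed_past.mem_of_tendsto (tendsto_projPast f) (Eventually.of_forall fun _ =>
    Submodule.sum_mem _ fun n _ => averageHol_circlePow_mem_past two_pos_real n f)

lemma projFuture_mem (f : HOmega) : projFuture f ∈ future :=
  isClosed_future.mem_of_tendsto (tendsto_projFuture f) (Eventually.of_forall fun _ =>
    Submodule.sum_mem _ fun n _ =>
      averageHol_circlePow_mem_future half_pos_real n.succ_pos f)

lemma projPast_add_projFuture (f : HOmega) : projPast f + projFuture f = f := by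
  refine DFunLike.ext _ _ fun x => ?_
  have h1 : projPast f x = Real.circleAverage (fun z => (1 - z⁻¹)⁻¹ * f (rot z x)) 0 2 :=
    average_eq_circleAverage two_pos_real (K := fun z => (1 - z⁻¹)⁻¹) (fun _ => rfl) f.1 x
  have h2 : projFuture f x = Real.circleAverage (fun z => z * (1 - z)⁻¹ * f (rot z x)) 0 2⁻¹ :=
    average_eq_circleAverage half_pos_real (K := fun z => z * (1 - z)⁻¹) (fun _ => rfl) f.1 x
  have h := circleAverage_annulus (f.isHolomorphic.differentiableOn_rot x)
  rw [← h1, ← h2, rot_one] at h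
  exact h

lemma future_le_ker_projPast : future ≤ LinearMap.ker (projPast : HOmega →ₗ[ℂ] HOmega) := by
  refine Submodule.topologicalClosure_minimal _ (Submodule.span_le.2 ?_)
    (isClosed_singleton.preimage projPast.continuous)
  rintro _ ⟨p, q, hpq, rfl⟩
  refine tendsto_nhds_unique (tendsto_projPast (basisElt p q)) ?_
  refine tendsto_const_nhds.congr fun N => (Finset.sum_eq_zero fun n _ => ?_).symm
  exact averageHol_circlePow_basisElt two_pos_real (by omega)

lemma past_le_ker_projFuture : past ≤ LinearMap.ker (projFuture : HOmega →ₗ[ℂ] HOmega) := by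
  refine Submodule.topologicalClosure_minimal _ (Submodule.span_le.2 ?_)
    (isClosed_singleton.preimage projFuture.continuous)
  rintro _ ⟨p, q, hpq, rfl⟩
  refine tendsto_nhds_unique (tendsto_projFuture (basisElt p q)) ?_
  refine tendsto_const_nhds.congr fun N => (Finset.sum_eq_zero fun n _ => ?_).symm
  exact averageHol_circlePow_basisElt half_pos_real (by omega)

lemma projPast_of_mem_past {f : HOmega} (hf : f ∈ past) : projPast f = f := by
  have h := projPast_add_projFuture f
  rwa [show projFuture f = 0 from past_le_ker_projFuture hf, add_zero] at h

end OmegaPaper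

end

theorem theorem4p2 :
    IsClosed (OmegaPaper.past : Set OmegaPaper.HOmega) ∧
    IsClosed (OmegaPaper.future : Set OmegaPaper.HOmega) ∧
    Submodule.IsTopCompl OmegaPaper.past OmegaPaper.future := by
  refine ⟨OmegaPaper.isClosed_past, OmegaPaper.isClosed_future, ?_⟩
  have hidem : IsIdempotentElem OmegaPaper.projPast := ContinuousLinearMap.ext fun f =>
    OmegaPaper.projPast_of_mem_past (OmegaPaper.projPast_mem f)
  have h := ContinuousLinearMap.IsIdempotentElem.isTopCompl hidem
  have hr : LinearMap.range (OmegaPaper.projPast : OmegaPaper.HOmega →ₗ[ℂ] OmegaPaper.HOmega) =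
      OmegaPaper.past := by
    refine le_antisymm ?_ fun f hf => ⟨f, OmegaPaper.projPast_of_mem_past hf⟩
    rintro _ ⟨f, rfl⟩
    exact OmegaPaper.projPast_mem f
  have hk : LinearMap.ker (OmegaPaper.projPast : OmegaPaper.HOmega →ₗ[ℂ] OmegaPaper.HOmega) =
      OmegaPaper.future := by
    refine le_antisymm (fun f hf => ?_) OmegaPaper.future_le_ker_projPast
    have hf0 : OmegaPaper.projPast f = 0 := hf
    rw [← OmegaPaper.projPast_add_projFuture f, hf0, zero_add]
    exact OmegaPaper.projFuture_mem f
  rwa [hr, hk] at h
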